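/- Let $k\in 2\mathbb Z$, and for $z=x+iy$ in the upper half-plane $\mathbb H$ put $$\Delta_k=y^2\Big(\frac{\partial^2}{\partial x^2}+\frac{\partial^2}{\partial y^2}\Big)-iky\Big(\frac{\partial}{\partial x}+i\frac{\partial}{\partial y}\Big).$$ For $\lambda\in\mathbb C$ and an integer $m\ge 0$ let $V_k^m(\lambda)$ be the space of smooth functions $f:\mathbb H\to\mathbb C$ such that $f\big(\frac{az+b}{cz+d}\big)=(cz+d)^kf(z)$ for all $\begin{pmatrix}a&b\\c&d\end{pmatrix}\in \mathrm{SL}(2,\mathbb Z)$, $f(x+iy)=O(y^K)$ as $y\to\infty$, uniformly in $x$, for some $K$, and $(\Delta_k-\lambda)^mf=0$. The series $$E_k(z,s)=\frac12\sum_{(m,n)\in\mathbb Z^2\setminus\{(0,0)\}}\frac{y^s}{|mz+n|^{2s}(mz+n)^k}$$ converges absolutely for $\operatorname{Re}s>1-\frac k2$, and for each $z\in\mathbb H$ the function $$\widehat{\widehat E}_k(z,s)=\Big(s+\frac k2\Big)\Big(s+\frac k2-1\Big)\pi^{-s-\frac k2}\,\Gamma\Big(s+\frac k2+\frac{|k|}2\Big)E_k(z,s),$$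 defined there, extends to an entire function of $s\in\mathbb C$ (the doubly-completed Eisenstein series). For $s_0\in\mathbb C$ and $n\ge0$ let $$\widehat{\widehat E}{}^{[n]}_k(z;s_0)=\frac{\partial^n}{\partial s^n}\widehat{\widehat E}_k(z,s)\Big|_{s=s_0},$$ viewed as a function of $z\in\mathbb H$. **Theorem (Taylor Series Recursion).** Fix $s_0\in\mathbb C$ and set $\lambda=s_0(s_0+k-1)$. 1. For every integer $n\ge0$ and all $z\in\mathbb H$, $$(\Delta_k-\lambda)\widehat{\widehat E}{}^{[n]}_k(z;s_0)=n(2s_0+k-1)\,\widehat{\widehat E}{}^{[n-1]}_k(z;s_0)+n(n-1)\,\widehat{\widehat E}{}^{[n-2]}_k(z;s_0),$$ where terms on the right with negative superscript are omitted. 2. For every integer $n\ge0$, $\widehat{\widehat E}{}^{[n]}_k(z;s_0)\in V_k^{n+1}(\lambda)$. -/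

import Mathlib

open scoped MatrixGroups ContDiff

noncomputable section

namespace PolyharmonicMaass

open UpperHalfPlane

/-- `∂f/∂x` for `f : ℍ → ℂ`, with `z = x + iy`. -/
def partialX (f : ℍ → ℂ) (z : ℍ) : ℂ :=
  deriv (fun t : ℝ => f (ofComplex ((z : ℂ) + (t : ℂ)))) 0

/-- `∂f/∂y` for `f : ℍ → ℂ`, with `z = x + iy`. -/
def partialY (f : ℍ → ℂ) (z : ℍ) : ℂ :=
  deriv (fun t : ℝ => f (ofComplex ((z : ℂ) + (t : ℂ) * Complex.I))) 0

/-- The weight `k` hyperbolic Laplacian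
`Δ_k = y² (∂²/∂x² + ∂²/∂y²) - i k y (∂/∂x + i ∂/∂y)`. -/
def laplacian (k : ℤ) (f : ℍ → ℂ) (z : ℍ) : ℂ :=
  (z.im : ℂ) ^ 2 * (partialX (partialX f) z + partialY (partialY f) z)
    - Complex.I * (k : ℂ) * (z.im : ℂ) * (partialX f z + Complex.I * partialY f z)

/-- The operator `Δ_k - lam`. -/
def shiftedLaplacian (k : ℤ) (lam : ℂ) (f : ℍ → ℂ) (z : ℍ) : ℂ :=
  laplacian k f z - lam * f z

/-- `f` is smooth as a function of the real variables `x, y`. -/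
def IsSmooth (f : ℍ → ℂ) : Prop :=
  ContDiffOn ℝ ∞ (fun w : ℂ => f (ofComplex w)) {w : ℂ | 0 < w.im}

/-- `f((az+b)/(cz+d)) = (cz+d)^k f(z)` for all `(a b; c d)` in `SL(2, ℤ)`. -/
def IsModularOfWeight (k : ℤ) (f : ℍ → ℂ) : Prop :=
  ∀ (γ : SL(2, ℤ)) (z : ℍ),
    f (γ • z) = (((γ 1 0 : ℤ) : ℂ) * (z : ℂ) + ((γ 1 1 : ℤ) : ℂ)) ^ k * f z

/-- At most polynomial growth in `y` as `y → ∞`, uniformly in `x`. -/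
def HasModerateGrowth (f : ℍ → ℂ) : Prop :=
  ∃ K : ℕ, f =O[atImInfty] fun z : ℍ => z.im ^ K

/-- The space `V_k^m(lam)` of shifted polyharmonic Maass forms for `PSL(2, ℤ)` of weight `k`,
depth (at most) `m` and eigenvalue `lam`. -/
def shiftedPolyharmonicMaassForms (k : ℤ) (m : ℕ) (lam : ℂ) : Set (ℍ → ℂ) :=
  {f | IsSmooth f ∧ IsModularOfWeight k f ∧ HasModerateGrowth f ∧
    ∀ z : ℍ, ((shiftedLaplacian k lam)^[m] f) z = 0}

/-- The term `y^s / (|mz+n|^(2s) (mz+n)^k)` at `p = (m, n)`. -/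
def eisensteinTerm (k : ℤ) (z : ℍ) (s : ℂ) (p : ℤ × ℤ) : ℂ :=
  (z.im : ℂ) ^ s /
    ((‖(p.1 : ℂ) * (z : ℂ) + (p.2 : ℂ)‖ : ℂ) ^ (2 * s) * ((p.1 : ℂ) * (z : ℂ) + (p.2 : ℂ)) ^ k)

/-- The series `E_k(z, s)`, absolutely convergent for `Re s > 1 - k/2`. -/
def eisensteinSeries (k : ℤ) (z : ℍ) (s : ℂ) : ℂ :=
  1 / 2 * ∑' p : {p : ℤ × ℤ // p ≠ 0}, eisensteinTerm k z s p.1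

/-- `(s + k/2) (s + k/2 - 1) π^(-s-k/2) Γ(s + k/2 + |k|/2) E_k(z, s)`, with `E_k(z, s)` given by
its series; only meaningful in the region of convergence. -/
def doublyCompletedSeries (k : ℤ) (z : ℍ) (s : ℂ) : ℂ :=
  (s + (k : ℂ) / 2) * (s + (k : ℂ) / 2 - 1) * (Real.pi : ℂ) ^ (-s - (k : ℂ) / 2)
    * Complex.Gamma (s + (k : ℂ) / 2 + ((|k| : ℤ) : ℂ) / 2) * eisensteinSeries k z s

/-- `F` is entire and equals the doubly-completed Eisenstein series at `z` for
`Re s > 1 - k/2`. By the identity theorem there is at most one such `F`. -/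
def IsEntireContinuation (k : ℤ) (z : ℍ) (F : ℂ → ℂ) : Prop :=
  Differentiable ℂ F ∧ ∀ s : ℂ, 1 - (k : ℝ) / 2 < s.re → F s = doublyCompletedSeries k z s

open Classical in
/-- The doubly-completed Eisenstein series as a function of `s ∈ ℂ`: the unique entire
continuation of `doublyCompletedSeries k z`. (If there were none, this would be the uncontinued
formula itself, which then does not satisfy `IsEntireContinuation`.) -/
def doublyCompletedEisenstein (k : ℤ) (z : ℍ) : ℂ → ℂ :=
  if h : ∃ F : ℂ → ℂ, IsEntireContinuation k z F then h.choose else doublyCompletedSeries k z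

/-- The `n`-th Taylor coefficient at `s₀`: the `n`-th `s`-derivative of the doubly-completed
Eisenstein series at `s = s₀`, as a function of `z`. -/
def taylorCoeff (k : ℤ) (n : ℕ) (s₀ : ℂ) (z : ℍ) : ℂ :=
  iteratedDeriv n (doublyCompletedEisenstein k z) s₀

end PolyharmonicMaass

end

/-! The recursion is the `n`-th `s`-derivative of one identity. In the half-plane of convergence
`E_k(z, s)` satisfies `Δ_k E = s (s + k - 1) E` (`laplacian_eisensteinSeries`). The completing
factor does not involve `z`, so the identity theorem in `s` carries the equation to the entire
function for every `s`. By Leibniz, the derivatives `2s + k - 1` and `2` of the quadratic `s (s + k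
- 1)` give the coefficients `n (2s₀ + k - 1)` and `n (n - 1)`. Thus `Δ_k - λ` lowers the Taylor
index, and `n + 1` applications annihilate the `n`-th coefficient. Modularity likewise passes from
the series to the continuation.

The analytic work is a continuation that is good jointly in `z` and `s`: smooth, of moderate growth,
with `∂/∂s` commuting with `Δ_k`. For this `x`, `y` and `s` all become complex variables on a tube
around the real points. Holomorphic functions there with polynomial growth in `y` (`IsTame`) are
closed under differentiation by Cauchy's formula (`differentiableOn_fderiv_apply`,
`IsTame.fderiv_apply`), and their mixed derivatives commute.

In weight `0` the continuation comes from Riemann's method: the inversion `latticeTheta_inv` and a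
Mellin transform split at `t = 1` give `1/2 + 1/2 s (s - 1) Σ incompleteMellin`. The lattice sum
converges for all `s`, and it extends to complex `x`, `y` because the quadratic form keeps positive
real part on the tube (`le_re_complexForm`). Raising operators (`IsTameContinuation.raise`) reach
the positive even weights, and `z ↦ -conj z` (`IsTameContinuation.reflect`) the negative ones. -/

noncomputable section

namespace PolyharmonicMaass

/-! ### Holomorphic functions of several variables: Cauchy's formula, parameter integrals,
smoothness. -/

section

open MeasureTheory Metric Filter Topology

section SeveralVariables

variable {E : Type*} [NormedAddCommGroup E] [NormedSpace ℂ E]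

/-- The slice of a function of several variables through `x` in the direction `v`. -/
theorem hasDerivAt_slice {f : E → ℂ} {x v : E} {ζ : ℂ} (hf : DifferentiableAt ℂ f (x + ζ • v)) :
    HasDerivAt (fun ζ : ℂ => f (x + ζ • v)) (fderiv ℂ f (x + ζ • v) v) ζ := by
  have h : HasDerivAt (fun ζ : ℂ => x + ζ • v) v ζ := by
    simpa using ((hasDerivAt_id ζ).smul_const v).const_add x
  exact hf.hasFDerivAt.comp_hasDerivAt ζ h

/-- Cauchy's estimate for the derivative of a bounded holomorphic function on a ball. -/
theorem norm_fderiv_le_of_norm_le_on_ball {f : E → ℂ} {x : E} {r C : ℝ} (hr : 0 < r)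
    (hf : DifferentiableOn ℂ f (ball x r)) (hC : ∀ y ∈ ball x r, ‖f y‖ ≤ C) :
    ‖fderiv ℂ f x‖ ≤ 2 * C / r := by
  have hC0 : 0 ≤ C := (norm_nonneg _).trans (hC x (mem_ball_self hr))
  refine ContinuousLinearMap.opNorm_le_bound _ (by positivity) fun v => ?_
  rcases eq_or_ne v 0 with rfl | hv
  · simp
  have hv' : 0 < ‖v‖ := norm_pos_iff.2 hv
  have hρ : 0 < r / (2 * ‖v‖) := by positivity
  have hmem : ∀ ζ ∈ closedBall (0 : ℂ) (r / (2 * ‖v‖)), x + ζ • v ∈ ball x r := by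
    intro ζ hζ
    rw [mem_closedBall_zero_iff] at hζ
    rw [mem_ball_iff_norm, add_sub_cancel_left, norm_smul]
    calc ‖ζ‖ * ‖v‖ ≤ r / (2 * ‖v‖) * ‖v‖ := by gcongr
      _ = r / 2 := by field_simp
      _ < r := by linarith
  have hd : ∀ ζ ∈ closedBall (0 : ℂ) (r / (2 * ‖v‖)),
      HasDerivAt (fun ζ : ℂ => f (x + ζ • v)) (fderiv ℂ f (x + ζ • v) v) ζ := fun ζ hζ =>
    hasDerivAt_slice (hf.differentiableAt (isOpen_ball.mem_nhds (hmem ζ hζ)))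
  have h := Complex.norm_deriv_le_of_forall_mem_sphere_norm_le (c := 0)
    (f := fun ζ : ℂ => f (x + ζ • v)) hρ
    (DifferentiableOn.diffContOnCl_ball (U := closedBall (0 : ℂ) (r / (2 * ‖v‖)))
      (fun ζ hζ => (hd ζ hζ).differentiableAt.differentiableWithinAt) subset_rfl)
    (fun ζ hζ => hC _ (hmem ζ (sphere_subset_closedBall hζ)))
  rw [(hd 0 (mem_closedBall_self hρ.le)).deriv] at h
  simp only [zero_smul, add_zero] at h
  refine h.trans (le_of_eq ?_)
  field_simp

/-- In finite dimension a functional is a combination of coordinates with its values on a basis as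
coefficients, so measurability can be tested on vectors. -/
theorem aestronglyMeasurable_clm [FiniteDimensional ℂ E] {α : Type*} [MeasurableSpace α]
    {μ : Measure α} {L : α → E →L[ℂ] ℂ} (h : ∀ v, AEStronglyMeasurable (fun a => L a v) μ) :
    AEStronglyMeasurable L μ := by
  let b := Module.finBasis ℂ E
  have key : L = fun a => ∑ i, (L a (b i)) • LinearMap.toContinuousLinearMap (b.coord i) := by
    funext a
    ext v
    have hv := congrArg (L a) (b.sum_repr v)
    rw [map_sum] at hv
    rw [← hv]
    simp [mul_comm]
  rw [key]
  exact Finset.aestronglyMeasurable_fun_sum _ fun i _ => (h (b i)).smul_const _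

/-- An integral depending holomorphically on a parameter, with a locally uniform integrable
bound, is holomorphic in the parameter. -/
theorem differentiableOn_integral_of_locally_bounded [FiniteDimensional ℂ E] {α : Type*}
    [MeasurableSpace α] {μ : Measure α} {F : E → α → ℂ} {U : Set E}
    (hmeas : ∀ x ∈ U, AEStronglyMeasurable (F x) μ)
    (hbound : ∀ x ∈ U, ∃ ε > 0, ball x ε ⊆ U ∧ ∃ b : α → ℝ, Integrable b μ ∧
      ∀ᵐ a ∂μ, DifferentiableOn ℂ (fun y => F y a) (ball x ε) ∧ ∀ y ∈ ball x ε, ‖F y a‖ ≤ b a) :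
    DifferentiableOn ℂ (fun x => ∫ a, F x a ∂μ) U := by
  intro x hx
  obtain ⟨ε, hε, hεU, b, hb, hF⟩ := hbound x hx
  have hsub : ∀ y ∈ ball x (ε / 2), ball y (ε / 2) ⊆ ball x ε := fun y hy =>
    ball_subset_ball' (by rw [mem_ball] at hy; linarith)
  have hU : ∀ᶠ y in 𝓝 x, y ∈ U := mem_of_superset (ball_mem_nhds x hε) hεU
  refine (hasFDerivAt_integral_of_dominated_of_fderiv_le (F' := fun y a => fderiv ℂ (F · a) y)
    (bound := fun a => 2 * b a / (ε / 2))
    (ball_mem_nhds x (half_pos hε)) (hU.mono hmeas) ?_ ?_ ?_ ?_ ?_).differentiableAt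
      |>.differentiableWithinAt
  · exact hb.mono' (hmeas x hx) (hF.mono fun a ha => ha.2 x (mem_ball_self hε))
  -- The derivative in the direction `v` is a pointwise limit of difference quotients; discarding
  -- the first `N` keeps the sample points inside `U`, where measurability is given.
  · refine aestronglyMeasurable_clm fun v => ?_
    obtain ⟨N, hN⟩ : ∃ N : ℕ, ∀ n ≥ N, x + ((n : ℂ) + 1)⁻¹ • v ∈ U := by
      have ht : Tendsto (fun n : ℕ => x + ((n : ℂ) + 1)⁻¹ • v) atTop (𝓝 x) := by
        have : Tendsto (fun n : ℕ => ((n : ℂ) + 1)⁻¹) atTop (𝓝 0) := by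
          simpa using tendsto_one_div_add_atTop_nhds_zero_nat (𝕜 := ℂ)
        simpa using (this.smul_const v).const_add x
      exact eventually_atTop.1 (ht.eventually hU)
    refine aestronglyMeasurable_of_tendsto_ae (u := atTop)
      (f := fun (n : ℕ) a => (((n + N : ℕ) : ℂ) + 1) • (F (x + (((n + N : ℕ) : ℂ) + 1)⁻¹ • v) a
        - F x a))
      (fun n => ((hmeas _ (hN (n + N) (Nat.le_add_left N n))).sub (hmeas x hx)).const_smul (((n + N : ℕ) : ℂ) + 1)) ?_
    filter_upwards [hF] with a ha
    have hd := (ha.1.differentiableAt (ball_mem_nhds x hε)).hasFDerivAt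
    have hc : Tendsto (fun n : ℕ => ‖(((n + N : ℕ) : ℂ) + 1)‖) atTop atTop := by
      have h1 : Tendsto (fun n : ℕ => (((n + N : ℕ) : ℝ) + 1)) atTop atTop :=
        tendsto_atTop_add_const_right _ _
          (tendsto_natCast_atTop_atTop.comp (tendsto_add_atTop_nat N))
      refine h1.congr fun n => ?_
      exact_mod_cast (Complex.norm_natCast (n + N + 1)).symm
    exact hd.lim v hc
  · filter_upwards [hF] with a ha y hy
    exact norm_fderiv_le_of_norm_le_on_ball (half_pos hε) (ha.1.mono (hsub y hy))
      fun z hz => ha.2 z (hsub y hy hz)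
  · simpa only [mul_div_assoc] using (hb.div_const (ε / 2)).const_mul 2
  · filter_upwards [hF] with a ha y hy
    exact (ha.1.differentiableAt (isOpen_ball.mem_nhds
      (ball_subset_ball (by linarith) hy))).hasFDerivAt

/-- Cauchy's formula on a disc in the direction `v` gives `∂_v f (y) = (2πi)⁻¹ ∮ ζ⁻² f (y + ζ v)
dζ`, and the right side can be differentiated in `y` under the integral. -/
theorem differentiableOn_fderiv_apply [FiniteDimensional ℂ E] {f : E → ℂ} {U : Set E}
    (hU : IsOpen U) (hf : DifferentiableOn ℂ f U) (v : E) :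
    DifferentiableOn ℂ (fun x => fderiv ℂ f x v) U := by
  intro x hx
  obtain ⟨ε, hε, hεU⟩ := Metric.isOpen_iff.1 hU x hx
  have hfc := hf.continuousOn
  obtain ⟨δ, hδ, hδU, C, hC⟩ : ∃ δ > 0, ball x δ ⊆ U ∧ ∃ C, ∀ y ∈ ball x δ, ‖f y‖ ≤ C := by
    have h := (hfc.continuousAt (hU.mem_nhds hx)).norm.eventually_lt_const
      (lt_add_one ‖f x‖)
    obtain ⟨δ, hδ, h⟩ := Metric.eventually_nhds_iff_ball.1 (h.and (hU.mem_nhds hx))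
    exact ⟨δ, hδ, fun y hy => (h y hy).2, _, fun y hy => (h y hy).1.le⟩
  -- Discs of radius `r` in the direction `v` about points of the half ball stay in `ball x δ`; the
  -- `+ 1` covers `v = 0`.
  set r : ℝ := δ / (2 * (‖v‖ + 1)) with hr
  have hr0 : 0 < r := by positivity
  have hmem : ∀ y ∈ ball x (δ / 2), ∀ ζ ∈ closedBall (0 : ℂ) r, y + ζ • v ∈ ball x δ := by
    intro y hy ζ hζ
    rw [mem_closedBall_zero_iff] at hζ
    rw [mem_ball_iff_norm] at hy ⊢
    have h1 : ‖ζ • v‖ ≤ δ / 2 := by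
      rw [norm_smul]
      calc ‖ζ‖ * ‖v‖ ≤ r * (‖v‖ + 1) := by gcongr; linarith
        _ = δ / 2 := by rw [hr]; field_simp
    calc ‖y + ζ • v - x‖ = ‖(y - x) + ζ • v‖ := by congr 1; abel
      _ ≤ ‖y - x‖ + ‖ζ • v‖ := norm_add_le _ _
      _ < δ := by linarith
  have hcm : ∀ θ : ℝ, circleMap 0 r θ ∈ closedBall (0 : ℂ) r := fun θ =>
    circleMap_mem_closedBall 0 hr0.le θ
  have hdiff : ∀ p ∈ ball x δ, DifferentiableAt ℂ f p := fun p hp =>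
    hf.differentiableAt (hU.mem_nhds (hδU hp))
  have hcauchy : ∀ y ∈ ball x (δ / 2), fderiv ℂ f y v = (2 * Real.pi * Complex.I)⁻¹ *
      ∫ θ in Set.Ioc 0 (2 * Real.pi), deriv (circleMap 0 r) θ *
        (1 / (circleMap 0 r θ) ^ 2 * f (y + circleMap 0 r θ • v)) := by
    intro y hy
    have hd : ∀ ζ ∈ closedBall (0 : ℂ) r,
        HasDerivAt (fun ζ : ℂ => f (y + ζ • v)) (fderiv ℂ f (y + ζ • v) v) ζ := fun ζ hζ =>
      hasDerivAt_slice (hdiff _ (hmem y hy ζ hζ))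
    have h := DifferentiableOn.deriv_eq_smul_circleIntegral (f := fun ζ : ℂ => f (y + ζ • v))
      hr0 (fun ζ hζ => (hd ζ hζ).differentiableAt.differentiableWithinAt)
    rw [(hd 0 (mem_closedBall_self hr0.le)).deriv, zero_smul, add_zero, circleIntegral,
      intervalIntegral.integral_of_le (by positivity)] at h
    simp only [sub_zero, smul_eq_mul] at h
    rw [h, inv_mul_cancel_left₀]
    simp [Real.pi_ne_zero]
  have hcont : ∀ y ∈ ball x (δ / 2), Continuous fun θ : ℝ => deriv (circleMap 0 r) θ *
        (1 / (circleMap 0 r θ) ^ 2 * f (y + circleMap 0 r θ • v)) := by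
    intro y hy
    have h1 : Continuous fun θ : ℝ => f (y + circleMap 0 r θ • v) :=
      (hfc.mono hδU).comp_continuous (continuous_const.add ((continuous_circleMap 0 r).smul
        continuous_const)) fun θ => hmem y hy _ (hcm θ)
    have h2 : ∀ θ, circleMap 0 r θ ^ 2 ≠ 0 := fun θ =>
      pow_ne_zero _ (circleMap_ne_center hr0.ne')
    simp only [deriv_circleMap]
    exact ((continuous_circleMap 0 r).mul continuous_const).mul
      ((continuous_const.div ((continuous_circleMap 0 r).pow 2) h2).mul h1)
  have hmain : DifferentiableOn ℂ (fun y => ∫ θ in Set.Ioc 0 (2 * Real.pi),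
      deriv (circleMap 0 r) θ * (1 / (circleMap 0 r θ) ^ 2 * f (y + circleMap 0 r θ • v)))
      (ball x (δ / 2)) := by
    refine differentiableOn_integral_of_locally_bounded
      (fun y hy => (hcont y hy).aestronglyMeasurable) fun y hy => ?_
    obtain ⟨ε', hε', hsub⟩ := Metric.isOpen_iff.1 isOpen_ball y hy
    refine ⟨ε', hε', hsub, fun _ => r⁻¹ * C, integrable_const _, ae_of_all _ fun θ => ⟨?_, ?_⟩⟩
    · intro p hp
      have h : DifferentiableAt ℂ (fun p => f (p + circleMap 0 r θ • v)) p :=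
        DifferentiableAt.comp p (hdiff _ (hmem p (hsub hp) _ (hcm θ)))
          (differentiableAt_id.add_const _)
      exact ((h.const_mul _).const_mul _).differentiableWithinAt
    · intro p hp
      rw [norm_mul, norm_mul, deriv_circleMap, norm_mul, norm_circleMap_zero, Complex.norm_I,
        norm_div, norm_pow, norm_circleMap_zero, norm_one, abs_of_pos hr0, ← mul_assoc]
      have := hC _ (hmem p (hsub hp) _ (hcm θ))
      have e : r * 1 * (1 / r ^ 2) = r⁻¹ := by field_simp
      rw [e]
      exact mul_le_mul_of_nonneg_left this (by positivity)
  have hx' : ball x (δ / 2) ∈ 𝓝 x := ball_mem_nhds x (half_pos hδ)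
  refine DifferentiableAt.differentiableWithinAt ?_
  exact ((hmain.differentiableAt hx').const_mul _).congr_of_eventuallyEq
    (mem_of_superset hx' hcauchy)

theorem contDiffOn_of_differentiableOn [FiniteDimensional ℂ E] {f : E → ℂ} {U : Set E}
    (hU : IsOpen U) (hf : DifferentiableOn ℂ f U) : ContDiffOn ℂ ∞ f U := by
  refine contDiffOn_infty.2 fun n => ?_
  induction n generalizing f with
  | zero => exact contDiffOn_zero.2 hf.continuousOn
  | succ n ih =>
    push_cast
    refine (contDiffOn_succ_iff_fderiv_of_isOpen hU).2 ⟨hf, by simp, ?_⟩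
    exact contDiffOn_clm_apply.2 fun v => ih (differentiableOn_fderiv_apply hU hf v)

theorem fderiv_fderiv_apply_comm [FiniteDimensional ℂ E] {f : E → ℂ} {U : Set E}
    (hU : IsOpen U) (hf : DifferentiableOn ℂ f U) {x : E} (hx : x ∈ U) (v w : E) :
    fderiv ℂ (fun y => fderiv ℂ f y v) x w = fderiv ℂ (fun y => fderiv ℂ f y w) x v := by
  have hc : ContDiffAt ℂ 2 f x :=
    (contDiffOn_infty.1 (contDiffOn_of_differentiableOn hU hf) 2).contDiffAt (hU.mem_nhds hx)
  have hd : DifferentiableAt ℂ (fderiv ℂ f) x :=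
    (hc.fderiv_right (m := 1) one_add_one_eq_two.le).differentiableAt (by simp)
  have hs : IsSymmSndFDerivAt ℂ f x := hc.isSymmSndFDerivAt (by simp)
  have key : ∀ v w, fderiv ℂ (fun y => fderiv ℂ f y v) x w = fderiv ℂ (fderiv ℂ f) x w v := by
    intro v w
    rw [fderiv_clm_apply hd (differentiableAt_const v)]
    simp
  rw [key, key]
  exact hs.eq _ _

end SeveralVariables

end

/-! ### Tame functions: holomorphic in complexified `(x, y, s)`, with polynomial growth in `y`. -/

section

open MeasureTheory Metric Filter Topology

/-- Complexified coordinates `(x, y, s)` close to the real upper half-plane. -/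
def complexTube : Set (ℂ × ℂ × ℂ) :=
  {p | |p.1.im| < p.2.1.re / 4 ∧ |p.2.1.im| < p.2.1.re / 4}

theorem isOpen_complexTube : IsOpen complexTube := by
  simp only [complexTube, Set.ofPred_and]
  refine IsOpen.inter (isOpen_lt ?_ ?_) (isOpen_lt ?_ ?_) <;> fun_prop

theorem ofReal_mem_complexTube (x : ℝ) {y : ℝ} (hy : 0 < y) (s : ℂ) :
    ((x : ℂ), (y : ℂ), s) ∈ complexTube := by
  simp [complexTube, hy]

theorem re_pos_of_mem_complexTube {p : ℂ × ℂ × ℂ} (hp : p ∈ complexTube) : 0 < p.2.1.re := by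
  have := (abs_nonneg _).trans_lt hp.1
  linarith

/-- `p` is close to the real point `(x, y, s)`, in every coordinate. -/
theorem coord_close {p q : ℂ × ℂ × ℂ} {δ : ℝ} (h : p ∈ ball q δ) :
    ‖p.1 - q.1‖ < δ ∧ ‖p.2.1 - q.2.1‖ < δ ∧ ‖p.2.2 - q.2.2‖ < δ := by
  rw [mem_ball_iff_norm, Prod.norm_def, max_lt_iff] at h
  have h2 := h.2
  rw [Prod.norm_def, max_lt_iff] at h2
  exact ⟨h.1, h2.1, h2.2⟩

theorem re_im_close {x y : ℝ} {s : ℂ} {p : ℂ × ℂ × ℂ} {δ : ℝ}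
    (h : p ∈ ball ((x : ℂ), (y : ℂ), s) δ) :
    |p.1.re - x| < δ ∧ |p.1.im| < δ ∧ |p.2.1.re - y| < δ ∧ |p.2.1.im| < δ := by
  obtain ⟨h1, h2, -⟩ := coord_close h
  refine ⟨?_, ?_, ?_, ?_⟩
  · simpa using (Complex.abs_re_le_norm _).trans_lt h1
  · simpa using (Complex.abs_im_le_norm _).trans_lt h1
  · simpa using (Complex.abs_re_le_norm _).trans_lt h2
  · simpa using (Complex.abs_im_le_norm _).trans_lt h2

theorem ball_subset_complexTube {x y : ℝ} {s : ℂ} {δ : ℝ} (hδ : δ ≤ 1 / 8) (hy : 1 ≤ y) :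
    ball ((x : ℂ), (y : ℂ), s) δ ⊆ complexTube := by
  intro p hp
  obtain ⟨-, h2, h3, h4⟩ := re_im_close hp
  have := (abs_lt.1 h3).1
  constructor <;> linarith

/-- Holomorphic functions of the complexified coordinates `(x, y, s)` which have moderate growth
as `y → ∞`, locally uniformly in `x` and `s`. -/
structure IsTame (Φ : ℂ × ℂ × ℂ → ℂ) : Prop where
  differentiableOn : DifferentiableOn ℂ Φ complexTube
  growth : ∀ A R : ℝ, ∃ δ > 0, δ ≤ 1 / 8 ∧ ∃ (C : ℝ) (K : ℕ), ∀ (x y : ℝ) (s : ℂ), |x| ≤ A → 1 ≤ y →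
    ‖s‖ ≤ R → ∀ p ∈ ball ((x : ℂ), (y : ℂ), s) δ, ‖Φ p‖ ≤ C * y ^ K

namespace IsTame

variable {Φ Ψ : ℂ × ℂ × ℂ → ℂ}

theorem add (hΦ : IsTame Φ) (hΨ : IsTame Ψ) : IsTame (fun p => Φ p + Ψ p) := by
  refine ⟨hΦ.differentiableOn.add hΨ.differentiableOn, fun A R => ?_⟩
  obtain ⟨δ, hδ, hδ', C, K, h⟩ := hΦ.growth A R
  obtain ⟨δ₂, hδ₂, hδ₂', C₂, K₂, h₂⟩ := hΨ.growth A R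
  refine ⟨min δ δ₂, lt_min hδ hδ₂, (min_le_left _ _).trans hδ', |C| + |C₂|, K + K₂,
    fun x y s hx hy hs p hp => ?_⟩
  have h1 := h x y s hx hy hs p (ball_subset_ball (min_le_left _ _) hp)
  have h2 := h₂ x y s hx hy hs p (ball_subset_ball (min_le_right _ _) hp)
  calc ‖Φ p + Ψ p‖ ≤ C * y ^ K + C₂ * y ^ K₂ := (norm_add_le _ _).trans (add_le_add h1 h2)
    _ ≤ |C| * y ^ (K + K₂) + |C₂| * y ^ (K + K₂) := by
      gcongr
      · exact le_abs_self C
      · lia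
      · exact le_abs_self C₂
      · lia
    _ = _ := by ring

theorem mul (hΦ : IsTame Φ) (hΨ : IsTame Ψ) : IsTame (fun p => Φ p * Ψ p) := by
  refine ⟨hΦ.differentiableOn.mul hΨ.differentiableOn, fun A R => ?_⟩
  obtain ⟨δ, hδ, hδ', C, K, h⟩ := hΦ.growth A R
  obtain ⟨δ₂, hδ₂, hδ₂', C₂, K₂, h₂⟩ := hΨ.growth A R
  refine ⟨min δ δ₂, lt_min hδ hδ₂, (min_le_left _ _).trans hδ', C * C₂, K + K₂,
    fun x y s hx hy hs p hp => ?_⟩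
  have h1 := h x y s hx hy hs p (ball_subset_ball (min_le_left _ _) hp)
  have h2 := h₂ x y s hx hy hs p (ball_subset_ball (min_le_right _ _) hp)
  calc ‖Φ p * Ψ p‖ ≤ (C * y ^ K) * (C₂ * y ^ K₂) := by
        rw [norm_mul]
        exact mul_le_mul h1 h2 (norm_nonneg _) ((norm_nonneg _).trans h1)
    _ = _ := by ring

theorem const (c : ℂ) : IsTame (fun _ => c) :=
  ⟨differentiableOn_const c, fun _ _ => ⟨1 / 8, by norm_num, le_rfl, ‖c‖, 0, by simp⟩⟩

theorem snd_fst : IsTame (fun p => p.2.1) := by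
  refine ⟨by fun_prop, fun A R => ⟨1 / 8, by norm_num, le_rfl, 2, 1, fun x y s hx hy hs p hp => ?_⟩⟩
  have h := (coord_close hp).2.1
  calc ‖p.2.1‖ = ‖(p.2.1 - (y : ℂ)) + (y : ℂ)‖ := by ring_nf
    _ ≤ ‖p.2.1 - (y : ℂ)‖ + ‖(y : ℂ)‖ := norm_add_le _ _
    _ ≤ 1 + y := by
      rw [Complex.norm_real, Real.norm_of_nonneg (by linarith)]
      simp only at h
      linarith
    _ ≤ 2 * y ^ 1 := by linarith

theorem snd_fst_inv : IsTame (fun p => p.2.1⁻¹) := by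
  have hne : ∀ p ∈ complexTube, p.2.1 ≠ 0 := fun p hp h => by
    have := re_pos_of_mem_complexTube hp
    simp [h] at this
  refine ⟨DifferentiableOn.inv (by fun_prop) hne, fun A R => ⟨1 / 8, by norm_num, le_rfl, 2, 0,
    fun x y s hx hy hs p hp => ?_⟩⟩
  have h := (abs_lt.1 (re_im_close hp).2.2.1).1
  have h1 : 1 / 2 ≤ ‖p.2.1‖ := by
    have := (le_abs_self _).trans (Complex.abs_re_le_norm p.2.1)
    linarith
  rw [norm_inv, pow_zero, mul_one]
  exact inv_le_of_inv_le₀ (by norm_num) (by linarith)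

theorem snd_snd : IsTame (fun p => p.2.2) := by
  refine ⟨by fun_prop, fun A R => ⟨1 / 8, by norm_num, le_rfl, R + 1, 0,
    fun x y s hx hy hs p hp => ?_⟩⟩
  have h := (coord_close hp).2.2
  calc ‖p.2.2‖ = ‖(p.2.2 - s) + s‖ := by ring_nf
    _ ≤ ‖p.2.2 - s‖ + ‖s‖ := norm_add_le _ _
    _ ≤ (R + 1) * y ^ 0 := by
      simp only at h
      linarith

theorem pow (hΦ : IsTame Φ) (n : ℕ) : IsTame (fun p => Φ p ^ n) := by
  induction n with
  | zero => simpa using const 1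
  | succ n ih => simpa only [pow_succ] using ih.mul hΦ

/-- This is why growth is required on complex balls and not only at real points: Cauchy's estimate
on balls of half the radius bounds the derivative with the same exponent `K`. -/
theorem fderiv_apply (hΦ : IsTame Φ) (v : ℂ × ℂ × ℂ) : IsTame (fun p => fderiv ℂ Φ p v) := by
  refine ⟨differentiableOn_fderiv_apply isOpen_complexTube hΦ.differentiableOn v, fun A R => ?_⟩
  obtain ⟨δ, hδ, hδ', C, K, h⟩ := hΦ.growth A R
  refine ⟨δ / 2, half_pos hδ, by linarith, 2 * C / (δ / 2) * ‖v‖, K, fun x y s hx hy hs p hp => ?_⟩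
  have hsub : ball p (δ / 2) ⊆ ball ((x : ℂ), (y : ℂ), s) δ :=
    ball_subset_ball' (by rw [mem_ball] at hp; linarith)
  have h1 := norm_fderiv_le_of_norm_le_on_ball (half_pos hδ)
    (hΦ.differentiableOn.mono (hsub.trans (ball_subset_complexTube hδ' hy)))
    fun q hq => h x y s hx hy hs q (hsub hq)
  calc ‖fderiv ℂ Φ p v‖ ≤ ‖fderiv ℂ Φ p‖ * ‖v‖ := ContinuousLinearMap.le_opNorm _ _
    _ ≤ (2 * (C * y ^ K) / (δ / 2)) * ‖v‖ := by gcongr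
    _ = _ := by ring

/-- An isometry carries balls to balls of the same radius, so the growth bound transfers once real
points go to real points with the same `y`. -/
theorem comp_isometry (hΦ : IsTame Φ) {g : ℂ × ℂ × ℂ → ℂ × ℂ × ℂ} (hg : Differentiable ℂ g)
    (hiso : Isometry g) (hmaps : ∀ p ∈ complexTube, g p ∈ complexTube)
    (hreal : ∀ A R : ℝ, ∃ A' R' : ℝ, ∀ (x y : ℝ) (s : ℂ), |x| ≤ A → ‖s‖ ≤ R →
      ∃ (x' : ℝ) (s' : ℂ), |x'| ≤ A' ∧ ‖s'‖ ≤ R' ∧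
        g ((x : ℂ), (y : ℂ), s) = ((x' : ℂ), (y : ℂ), s')) :
    IsTame (fun p => Φ (g p)) := by
  refine ⟨hΦ.differentiableOn.comp hg.differentiableOn hmaps, fun A R => ?_⟩
  obtain ⟨A', R', hAR⟩ := hreal A R
  obtain ⟨δ, hδ, hδ', C, K, h⟩ := hΦ.growth A' R'
  refine ⟨δ, hδ, hδ', C, K, fun x y s hx hy hs p hp => ?_⟩
  obtain ⟨x', s', hx', hs', he⟩ := hAR x y s hx hs
  refine h x' y s' hx' hy hs' (g p) ?_
  rw [← he, mem_ball, hiso.dist_eq]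
  exact hp

theorem shift (hΦ : IsTame Φ) (c : ℂ) : IsTame (fun p => Φ (p.1, p.2.1, p.2.2 + c)) := by
  refine hΦ.comp_isometry (g := fun p => (p.1, p.2.1, p.2.2 + c)) (by fun_prop) ?_
    (fun p hp => hp) fun A R => ⟨A, R + ‖c‖, fun x y s hx hs => ⟨x, s + c, hx, ?_, rfl⟩⟩
  · exact Isometry.of_dist_eq fun p q => by simp [Prod.dist_eq]
  · exact (norm_add_le _ _).trans (by linarith)

theorem reflect (hΦ : IsTame Φ) : IsTame (fun p => Φ (-p.1, p.2.1, p.2.2)) := by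
  refine hΦ.comp_isometry (g := fun p => (-p.1, p.2.1, p.2.2)) (by fun_prop) ?_
    (fun p hp => ?_) fun A R => ⟨A, R, fun x y s hx hs => ⟨-x, s, by simpa using hx, hs, by simp⟩⟩
  · exact Isometry.of_dist_eq fun p q => by simp [Prod.dist_eq]
  · simpa [complexTube] using hp

end IsTame

end

/-! ### Convergence and directional derivatives of the Eisenstein series. -/

section

open Filter Topology

/-- The term of the Eisenstein series, as a function on `ℂ`. -/
def planeTerm (k : ℤ) (w s : ℂ) (p : ℤ × ℤ) : ℂ :=
  (w.im : ℂ) ^ s / ((‖(p.1 : ℂ) * w + (p.2 : ℂ)‖ : ℂ) ^ (2 * s) * ((p.1 : ℂ) * w + (p.2 : ℂ)) ^ k)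

theorem linear_ne_zero {w : ℂ} (hw : 0 < w.im) {p : ℤ × ℤ} (hp : p ≠ 0) :
    (p.1 : ℂ) * w + (p.2 : ℂ) ≠ 0 := by
  intro h
  have him := congrArg Complex.im h
  have hre := congrArg Complex.re h
  simp only [Complex.add_im, Complex.mul_im, Complex.intCast_re, Complex.intCast_im, zero_mul,
    add_zero, Complex.zero_im, Complex.add_re, Complex.mul_re, sub_zero, Complex.zero_re] at him hre
  have h1 : p.1 = 0 := by
    rcases mul_eq_zero.1 him with h | h
    · exact_mod_cast h
    · exact absurd h hw.ne'
  have h2 : p.2 = 0 := by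
    rw [h1, Int.cast_zero, zero_mul, zero_add] at hre
    exact_mod_cast hre
  exact hp (Prod.ext h1 h2)

/-- Puts all dependence on `s` into the exponential of `s` times one real logarithm, avoiding branch
questions for complex powers. -/
theorem planeTerm_eq_exp (k : ℤ) {w : ℂ} (hw : 0 < w.im) (s : ℂ) {p : ℤ × ℤ} (hp : p ≠ 0) :
    planeTerm k w s p = Complex.exp (s * (Real.log (w.im /
      Complex.normSq ((p.1 : ℂ) * w + (p.2 : ℂ))) : ℂ)) * ((p.1 : ℂ) * w + (p.2 : ℂ)) ^ (-k) := by
  have ha := linear_ne_zero hw hp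
  set a := (p.1 : ℂ) * w + (p.2 : ℂ) with ha'
  have hn : 0 < ‖a‖ := norm_pos_iff.2 ha
  rw [planeTerm, ← ha', Complex.cpow_def_of_ne_zero (by exact_mod_cast hw.ne'),
    Complex.cpow_def_of_ne_zero (by exact_mod_cast hn.ne'), Complex.normSq_eq_norm_sq,
    Real.log_div hw.ne' (by positivity), Real.log_pow, zpow_neg, ← Complex.ofReal_log hw.le,
    ← Complex.ofReal_log hn.le, div_mul_eq_div_div, div_eq_mul_inv _ (a ^ k), ← Complex.exp_sub]
  congr 2
  push_cast
  ring

theorem norm_planeTerm (k : ℤ) {w : ℂ} (hw : 0 < w.im) (s : ℂ) {p : ℤ × ℤ} (hp : p ≠ 0) :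
    ‖planeTerm k w s p‖ =
      w.im ^ s.re * ‖(p.1 : ℂ) * w + (p.2 : ℂ)‖ ^ (-(2 * s.re + (k : ℝ))) := by
  have hn : 0 < ‖(p.1 : ℂ) * w + (p.2 : ℂ)‖ := norm_pos_iff.2 (linear_ne_zero hw hp)
  rw [planeTerm, norm_div, norm_mul, norm_zpow, Complex.norm_cpow_eq_rpow_re_of_pos hw,
    Complex.norm_cpow_eq_rpow_re_of_pos hn, Real.rpow_neg hn.le, Real.rpow_add hn,
    Real.rpow_intCast, div_eq_mul_inv]
  simp

/-- A convergent majorant for inverse powers of lattice points. -/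
theorem summable_latticeNorm {a : ℝ} (ha : 2 < a) :
    Summable fun p : {p : ℤ × ℤ // p ≠ 0} => ‖![p.1.1, p.1.2]‖ ^ (-a) := by
  have h := EisensteinSeries.summable_one_div_norm_rpow ha
  rw [← (finTwoArrowEquiv ℤ).symm.summable_iff] at h
  exact h.subtype _

/-- The lower bound of `‖mz+n‖ / ‖(m,n)‖` on a vertical strip. -/
def stripConst (A B : ℝ) : ℝ := if h : 0 < B then EisensteinSeries.r ⟨⟨A, B⟩, h⟩ else 1

theorem stripConst_pos (A B : ℝ) : 0 < stripConst A B := by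
  rw [stripConst]
  split_ifs with h
  · exact EisensteinSeries.r_pos _
  · exact one_pos

theorem norm_lattice_pos {p : ℤ × ℤ} (hp : p ≠ 0) : 0 < ‖![p.1, p.2]‖ := by
  rw [norm_pos_iff]
  intro h
  exact hp (Prod.ext (by simpa using congrFun h 0) (by simpa using congrFun h 1))

theorem stripConst_mul_le {A B : ℝ} (hB : 0 < B) {w : ℂ} (hA : |w.re| ≤ A) (hw : B ≤ w.im)
    {p : ℤ × ℤ} (hp : p ≠ 0) :
    stripConst A B * ‖![p.1, p.2]‖ ≤ ‖(p.1 : ℂ) * w + (p.2 : ℂ)‖ := by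
  let z : UpperHalfPlane := ⟨w, hB.trans_le hw⟩
  have h1 : stripConst A B ≤ EisensteinSeries.r z := by
    rw [stripConst, dif_pos hB]
    exact EisensteinSeries.r_lower_bound_on_verticalStrip z hB ⟨hA, hw⟩
  have h2 := EisensteinSeries.r_mul_max_le z (x := ![p.1, p.2]) fun h =>
    (norm_lattice_pos hp).ne' (by rw [h, norm_zero])
  refine le_trans ?_ (h2.trans (le_of_eq ?_))
  · gcongr
  · simp [z]

/-- Local uniform domination of the terms of the Eisenstein series. -/
theorem norm_planeTerm_le (k : ℤ) (s : ℂ) (hs : 2 < 2 * s.re + (k : ℝ)) {A B B' : ℝ} (hB : 0 < B) :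
    ∃ u : {p : ℤ × ℤ // p ≠ 0} → ℝ, Summable u ∧ ∀ (p : {p : ℤ × ℤ // p ≠ 0}) (w : ℂ),
      |w.re| ≤ A → B ≤ w.im → w.im ≤ B' → ‖planeTerm k w s p.1‖ ≤ u p := by
  -- The sum of the two endpoint powers bounds `w.im ^ s.re` whatever the sign of `s.re`.
  refine ⟨fun p => (B ^ s.re + B' ^ s.re) * (stripConst A B ^ (-(2 * s.re + (k : ℝ))) *
    ‖![p.1.1, p.1.2]‖ ^ (-(2 * s.re + (k : ℝ)))), ((summable_latticeNorm hs).mul_left _).mul_left _,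
    fun p w hA hw hw' => ?_⟩
  have hw0 : 0 < w.im := hB.trans_le hw
  have hr := stripConst_pos A B
  have hp := norm_lattice_pos p.2
  beta_reduce
  rw [norm_planeTerm k hw0 s p.2, ← Real.mul_rpow hr.le hp.le]
  refine mul_le_mul ?_ (Real.rpow_le_rpow_of_nonpos (mul_pos hr hp)
    (stripConst_mul_le hB hA hw p.2) (by linarith)) (by positivity) ?_
  · have h1 : 0 ≤ B ^ s.re := Real.rpow_nonneg hB.le _
    have h2 : 0 ≤ B' ^ s.re := Real.rpow_nonneg (hw0.le.trans hw') _
    rcases le_total 0 s.re with h | h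
    · exact (Real.rpow_le_rpow hw0.le hw' h).trans (by linarith)
    · exact (Real.rpow_le_rpow_of_nonpos hB hw h).trans (by linarith)
  · have h2 : 0 ≤ B' ^ s.re := Real.rpow_nonneg (hw0.le.trans hw') _
    positivity

/-- The directional derivative of a term of the Eisenstein series, in the direction `v`, expressed
through terms of weights `k`, `k + 2` and `k - 2`. -/
def planeTermDeriv (k : ℤ) (v w s : ℂ) (p : ℤ × ℤ) : ℂ :=
  v / (2 * Complex.I) * ((s + k) * planeTerm (k + 2) w (s - 1) p - k / w.im * planeTerm k w s p) +
    (starRingEnd ℂ) v * (Complex.I / (2 * w.im ^ 2)) * s * planeTerm (k - 2) w (s + 1) p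

/-- With `a = mw + n`, passing from `(k, s)` to `(k + 2, s - 1)` multiplies a term by `|a|² / (y a²)
= conj a / (a y)`. The quantity `2s + k`, which governs convergence, is unchanged. -/
theorem planeTerm_raise (k : ℤ) {w : ℂ} (hw : 0 < w.im) (s : ℂ) {p : ℤ × ℤ} (hp : p ≠ 0) :
    planeTerm (k + 2) w (s - 1) p = planeTerm k w s p *
      ((starRingEnd ℂ) ((p.1 : ℂ) * w + (p.2 : ℂ)) / (((p.1 : ℂ) * w + (p.2 : ℂ)) * w.im)) := by
  have ha := linear_ne_zero hw hp
  have hw' : (w.im : ℂ) ≠ 0 := by exact_mod_cast hw.ne'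
  rw [planeTerm_eq_exp _ hw _ hp, planeTerm_eq_exp _ hw _ hp]
  set a := (p.1 : ℂ) * w + (p.2 : ℂ) with ha'
  have hn : 0 < Complex.normSq a := Complex.normSq_pos.2 ha
  have hbar : (starRingEnd ℂ) a = (Complex.normSq a : ℂ) / a := by
    rw [Complex.normSq_eq_conj_mul_self]; field_simp
  have hn' : (Complex.normSq a : ℂ) ≠ 0 := by exact_mod_cast hn.ne'
  rw [sub_mul, one_mul, Complex.exp_sub, ← Complex.ofReal_exp, Real.exp_log (by positivity), hbar,
    neg_add, zpow_add₀ ha]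
  simp only [zpow_neg, zpow_ofNat]
  push_cast
  field_simp

theorem planeTerm_lower (k : ℤ) {w : ℂ} (hw : 0 < w.im) (s : ℂ) {p : ℤ × ℤ} (hp : p ≠ 0) :
    planeTerm (k - 2) w (s + 1) p = planeTerm k w s p *
      ((((p.1 : ℂ) * w + (p.2 : ℂ)) * w.im) / (starRingEnd ℂ) ((p.1 : ℂ) * w + (p.2 : ℂ))) := by
  have h := planeTerm_raise (k - 2) hw (s + 1) hp
  have ha := linear_ne_zero hw hp
  have ha' : (starRingEnd ℂ) ((p.1 : ℂ) * w + (p.2 : ℂ)) ≠ 0 :=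
    (map_ne_zero (starRingEnd ℂ)).2 ha
  have hw' : (w.im : ℂ) ≠ 0 := by exact_mod_cast hw.ne'
  rw [sub_add_cancel, add_sub_cancel_right] at h
  rw [h]
  field_simp

/-- The two summands of `planeTermDeriv` are the Wirtinger parts `v ∂_w` and `conj v ∂_w̄`.
Factoring the neighbouring weights through the original term turns the claim into a rational
identity in `a`, `conj a`, `y`, `v`, `conj v`. -/
theorem hasDerivAt_planeTerm (k : ℤ) (v w s : ℂ) (t : ℝ) (hw : 0 < (w + t * v).im) {p : ℤ × ℤ}
    (hp : p ≠ 0) :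
    HasDerivAt (fun t : ℝ => planeTerm k (w + t * v) s p) (planeTermDeriv k v (w + t * v) s p) t := by
  have hlin : HasDerivAt (fun t : ℝ => w + t * v) v t := by
    simpa using ((hasDerivAt_id t).ofReal_comp.mul_const v).const_add w
  have hlina : HasDerivAt (fun t : ℝ => (p.1 : ℂ) * (w + t * v) + (p.2 : ℂ)) ((p.1 : ℂ) * v) t :=
    (hlin.const_mul _).add_const _
  have him : HasDerivAt (fun t : ℝ => (w + t * v).im) v.im t := by
    have := Complex.imCLM.hasFDerivAt.comp_hasDerivAt t hlin
    exact this
  have ha := linear_ne_zero hw hp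
  have hns : HasDerivAt (fun t : ℝ => Complex.normSq ((p.1 : ℂ) * (w + t * v) + (p.2 : ℂ)))
      (2 * (((p.1 : ℂ) * (w + t * v) + (p.2 : ℂ)).re * ((p.1 : ℂ) * v).re +
        ((p.1 : ℂ) * (w + t * v) + (p.2 : ℂ)).im * ((p.1 : ℂ) * v).im)) t := by
    have h1 : HasDerivAt (fun t : ℝ => ((p.1 : ℂ) * (w + t * v) + (p.2 : ℂ)).re)
      ((p.1 : ℂ) * v).re t := Complex.reCLM.hasFDerivAt.comp_hasDerivAt t hlina
    have h2 : HasDerivAt (fun t : ℝ => ((p.1 : ℂ) * (w + t * v) + (p.2 : ℂ)).im)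
      ((p.1 : ℂ) * v).im t := Complex.imCLM.hasFDerivAt.comp_hasDerivAt t hlina
    simp only [Complex.normSq_apply]
    convert! (h1.mul h1).add (h2.mul h2) using 1
    ring
  have hn : 0 < Complex.normSq ((p.1 : ℂ) * (w + t * v) + (p.2 : ℂ)) := Complex.normSq_pos.2 ha
  have hlog := ((him.div hns hn.ne').log (div_pos hw hn).ne').ofReal_comp
  have hexp := (hlog.const_mul s).cexp
  have hz : HasDerivAt (fun t : ℝ => ((p.1 : ℂ) * (w + t * v) + (p.2 : ℂ)) ^ (-k))
      (((-k : ℤ) : ℂ) * ((p.1 : ℂ) * (w + t * v) + (p.2 : ℂ)) ^ (-k - 1) * ((p.1 : ℂ) * v)) t :=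
    (hasDerivAt_zpow (-k) _ (Or.inl ha)).comp (h₂ := fun x : ℂ => x ^ (-k)) t hlina
  have hprod := hexp.mul hz
  have hev : ∀ᶠ t' : ℝ in 𝓝 t, 0 < (w + t' * v).im :=
    him.continuousAt.eventually (lt_mem_nhds hw)
  refine (hprod.congr_of_eventuallyEq (hev.mono fun t' ht' => ?_)).congr_deriv ?_
  · exact planeTerm_eq_exp k ht' s hp
  · rw [planeTermDeriv, planeTerm_raise k hw s hp, planeTerm_lower k hw s hp,
      planeTerm_eq_exp k hw s hp]
    have hconj : (starRingEnd ℂ) ((p.1 : ℂ) * (w + t * v) + (p.2 : ℂ)) =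
        ((p.1 : ℂ) * (w + t * v) + (p.2 : ℂ)) - 2 * Complex.I * p.1 * (w + t * v).im := by
      apply Complex.ext <;> simp <;> ring
    have hv : (v.im : ℂ) = (v - (starRingEnd ℂ) v) / (2 * Complex.I) := by
      apply Complex.ext <;> simp [Complex.div_im, Complex.div_re] <;> ring
    have hre : (((2 * (((p.1 : ℂ) * (w + t * v) + (p.2 : ℂ)).re * ((p.1 : ℂ) * v).re +
        ((p.1 : ℂ) * (w + t * v) + (p.2 : ℂ)).im * ((p.1 : ℂ) * v).im)) : ℝ) : ℂ) =
        p.1 * (v * (starRingEnd ℂ) ((p.1 : ℂ) * (w + t * v) + (p.2 : ℂ)) +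
          (starRingEnd ℂ) v * ((p.1 : ℂ) * (w + t * v) + (p.2 : ℂ))) := by
      apply Complex.ext
      · simp
        ring
      · simp
        right
        ring
    have hnsq := Complex.normSq_eq_conj_mul_self (z := (p.1 : ℂ) * (w + t * v) + (p.2 : ℂ))
    have hw' : ((w + t * v).im : ℂ) ≠ 0 := by exact_mod_cast hw.ne'
    have hb : (starRingEnd ℂ) ((p.1 : ℂ) * (w + t * v) + (p.2 : ℂ)) ≠ 0 :=
      (map_ne_zero (starRingEnd ℂ)).2 ha
    have hm : (p.1 : ℂ) = (((p.1 : ℂ) * (w + t * v) + (p.2 : ℂ)) -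
        (starRingEnd ℂ) ((p.1 : ℂ) * (w + t * v) + (p.2 : ℂ))) /
          (2 * Complex.I * (w + t * v).im) := by
      rw [hconj]
      field_simp
      ring
    -- After this `I` enters only through `1 / I`, to the same degree on both sides, so it can be
    -- replaced by a nonzero indeterminate.
    have hI : Complex.I / (2 * ((w + t * v).im : ℂ) ^ 2) =
        -1 / (2 * Complex.I * ((w + t * v).im : ℂ) ^ 2) := by
      field_simp
      simp
    rw [hI]
    simp only [Pi.div_apply]
    rw [Complex.ofReal_div, Complex.ofReal_div, Complex.ofReal_div, Complex.ofReal_sub,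
      Complex.ofReal_mul, Complex.ofReal_mul, hre, hv, Complex.ofReal_pow, hnsq, zpow_sub_one₀ ha]
    generalize Complex.exp _ = e
    generalize ((p.1 : ℂ) * (w + t * v) + (p.2 : ℂ)) ^ (-k) = E
    generalize (starRingEnd ℂ) ((p.1 : ℂ) * (w + t * v) + (p.2 : ℂ)) = b at *
    generalize (p.1 : ℂ) * (w + t * v) + (p.2 : ℂ) = a at *
    generalize (((w + t * v).im : ℝ) : ℂ) = y at *
    rw [hm]
    generalize hj : Complex.I = j at *
    have hj0 : j ≠ 0 := by rw [← hj]; exact Complex.I_ne_zero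
    push_cast
    field_simp
    ring

/-- The Eisenstein series as a function on `ℂ`. -/
def planeSeries (k : ℤ) (w s : ℂ) : ℂ := 1 / 2 * ∑' p : {p : ℤ × ℤ // p ≠ 0}, planeTerm k w s p.1

theorem eisensteinSeries_eq (k : ℤ) (z : UpperHalfPlane) (s : ℂ) :
    eisensteinSeries k z s = planeSeries k z s := rfl

theorem summable_planeTerm (k : ℤ) {w : ℂ} (hw : 0 < w.im) {s : ℂ}
    (hs : 2 < 2 * s.re + (k : ℝ)) :
    Summable fun p : {p : ℤ × ℤ // p ≠ 0} => planeTerm k w s p.1 := by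
  obtain ⟨u, hu, h⟩ := norm_planeTerm_le k s hs (A := |w.re|) (B := w.im) (B' := w.im) hw
  exact Summable.of_norm_bounded hu fun p => h p w le_rfl le_rfl le_rfl

/-- The directional derivative of the Eisenstein series. -/
theorem hasDerivAt_planeSeries (k : ℤ) {w : ℂ} (hw : 0 < w.im) {s : ℂ}
    (hs : 2 < 2 * s.re + (k : ℝ)) (v : ℂ) :
    HasDerivAt (fun t : ℝ => planeSeries k (w + t * v) s)
      (v / (2 * Complex.I) * ((s + k) * planeSeries (k + 2) w (s - 1)
        - k / w.im * planeSeries k w s) +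
      (starRingEnd ℂ) v * (Complex.I / (2 * w.im ^ 2)) * s * planeSeries (k - 2) w (s + 1)) 0 := by
  have hs1 : 2 < 2 * (s - 1).re + ((k + 2 : ℤ) : ℝ) := by
    push_cast; simp only [Complex.sub_re, Complex.one_re]; linarith
  have hs2 : 2 < 2 * (s + 1).re + ((k - 2 : ℤ) : ℝ) := by
    push_cast; simp only [Complex.add_re, Complex.one_re]; linarith
  have hB : 0 < w.im / 2 := half_pos hw
  obtain ⟨u0, hu0, h0⟩ := norm_planeTerm_le k s hs (A := |w.re| + w.im) (B' := 2 * w.im) hB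
  obtain ⟨u1, hu1, h1⟩ := norm_planeTerm_le (k + 2) (s - 1) hs1 (A := |w.re| + w.im)
    (B' := 2 * w.im) hB
  obtain ⟨u2, hu2, h2⟩ := norm_planeTerm_le (k - 2) (s + 1) hs2 (A := |w.re| + w.im)
    (B' := 2 * w.im) hB
  -- For `|t| < ρ` the displacement is at most `w.im / 2`, so one compact range of `y` serves all
  -- three majorants.
  set ρ : ℝ := w.im / (2 * (‖v‖ + 1)) with hρ
  have hρ0 : 0 < ρ := by positivity
  have hstrip : ∀ t ∈ Metric.ball (0 : ℝ) ρ, |(w + t * v).re| ≤ |w.re| + w.im ∧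
      w.im / 2 ≤ (w + t * v).im ∧ (w + t * v).im ≤ 2 * w.im := by
    intro t ht
    rw [mem_ball_zero_iff, Real.norm_eq_abs] at ht
    have hn : ‖(t : ℂ) * v‖ ≤ w.im / 2 := by
      rw [norm_mul, Complex.norm_real, Real.norm_eq_abs]
      calc |t| * ‖v‖ ≤ ρ * (‖v‖ + 1) := by gcongr; linarith
        _ = w.im / 2 := by rw [hρ]; field_simp
    have hre := (Complex.abs_re_le_norm _).trans hn
    have him := abs_le.1 ((Complex.abs_im_le_norm _).trans hn)
    rw [Complex.add_re, Complex.add_im]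
    refine ⟨(abs_add_le _ _).trans (by linarith), by linarith, by linarith⟩
  have hbound : ∀ (p : {p : ℤ × ℤ // p ≠ 0}) (t : ℝ), t ∈ Metric.ball (0 : ℝ) ρ →
      ‖planeTermDeriv k v (w + t * v) s p.1‖ ≤
        ‖v‖ / 2 * (‖s + k‖ * u1 p + ‖(k : ℂ)‖ / (w.im / 2) * u0 p) +
          ‖v‖ * (1 / (2 * (w.im / 2) ^ 2)) * ‖s‖ * u2 p := by
    intro p t ht
    obtain ⟨ha, hb, hc⟩ := hstrip t ht
    have e0 := h0 p _ ha hb hc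
    have e1 := h1 p _ ha hb hc
    have e2 := h2 p _ ha hb hc
    have him : ‖(((w + t * v).im : ℝ) : ℂ)‖ = (w + t * v).im := by
      rw [Complex.norm_real, Real.norm_of_nonneg (by linarith)]
    rw [planeTermDeriv]
    refine (norm_add_le _ _).trans (add_le_add ?_ ?_)
    · rw [norm_mul, norm_div, norm_mul, Complex.norm_I, mul_one, Complex.norm_ofNat]
      refine mul_le_mul_of_nonneg_left ((norm_sub_le _ _).trans (add_le_add ?_ ?_)) (by positivity)
      · rw [norm_mul]
        gcongr
      · rw [norm_mul, norm_div, him]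
        gcongr
    · rw [norm_mul, norm_mul, norm_mul, norm_div, norm_mul, norm_pow, him, Complex.norm_I,
        Complex.norm_ofNat, RCLike.norm_conj]
      gcongr
  have hder := hasDerivAt_tsum_of_isPreconnected
    (u := fun p : {p : ℤ × ℤ // p ≠ 0} =>
      ‖v‖ / 2 * (‖s + k‖ * u1 p + ‖(k : ℂ)‖ / (w.im / 2) * u0 p) +
          ‖v‖ * (1 / (2 * (w.im / 2) ^ 2)) * ‖s‖ * u2 p)
    (g := fun p (t : ℝ) => planeTerm k (w + t * v) s p.1)
    (g' := fun p (t : ℝ) => planeTermDeriv k v (w + t * v) s p.1)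
    ((((hu1.mul_left _).add (hu0.mul_left _)).mul_left _).add (hu2.mul_left _))
    Metric.isOpen_ball (convex_ball (0 : ℝ) ρ).isPreconnected
    (fun p t ht => hasDerivAt_planeTerm k v w s t (by have := (hstrip t ht).2.1; linarith) p.2)
    hbound (Metric.mem_ball_self hρ0) (by simpa using summable_planeTerm k hw hs)
    (Metric.mem_ball_self hρ0)
  refine (hder.const_mul (1 / 2 : ℂ)).congr_deriv ?_
  simp only [planeTermDeriv, Complex.ofReal_zero, zero_mul, add_zero]
  have S0 := summable_planeTerm k hw hs
  have S1 := summable_planeTerm (k + 2) hw hs1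
  have S2 := summable_planeTerm (k - 2) hw hs2
  rw [Summable.tsum_add (((S1.mul_left _).sub (S0.mul_left _)).mul_left _) (S2.mul_left _),
    tsum_mul_left, Summable.tsum_sub (S1.mul_left _) (S0.mul_left _), tsum_mul_left, tsum_mul_left,
    tsum_mul_left, planeSeries, planeSeries, planeSeries]
  ring

end

/-! ### The eigenvalue equation and modularity of the series. -/

section

open Filter Topology

theorem eventually_im_pos (z : UpperHalfPlane) (v : ℂ) :
    ∀ᶠ t : ℝ in 𝓝 0, 0 < ((z : ℂ) + t * v).im := by
  have hc : ContinuousAt (fun t : ℝ => ((z : ℂ) + t * v).im) 0 := by fun_prop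
  exact hc.eventually (lt_mem_nhds (by simpa using z.im_pos))

/-- Derivatives along lines in `ℍ` can be computed in `ℂ`. -/
theorem hasDerivAt_line {f : UpperHalfPlane → ℂ} {g : ℂ → ℂ} (hfg : ∀ z : UpperHalfPlane, f z = g z)
    {z : UpperHalfPlane} {v g' : ℂ} (h : HasDerivAt (fun t : ℝ => g (z + t * v)) g' 0) :
    HasDerivAt (fun t : ℝ => f (UpperHalfPlane.ofComplex (z + t * v))) g' 0 := by
  refine h.congr_of_eventuallyEq ((eventually_im_pos z v).mono fun t ht => ?_)
  simp only
  rw [hfg, UpperHalfPlane.ofComplex_apply_of_im_pos ht]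

theorem partialX_eq {f : UpperHalfPlane → ℂ} {g : ℂ → ℂ} (hfg : ∀ z : UpperHalfPlane, f z = g z)
    {z : UpperHalfPlane} {g' : ℂ} (h : HasDerivAt (fun t : ℝ => g (z + t * 1)) g' 0) :
    partialX f z = g' := by
  rw [partialX, ← (hasDerivAt_line hfg h).deriv]
  simp only [mul_one]

theorem partialY_eq {f : UpperHalfPlane → ℂ} {g : ℂ → ℂ} (hfg : ∀ z : UpperHalfPlane, f z = g z)
    {z : UpperHalfPlane} {g' : ℂ} (h : HasDerivAt (fun t : ℝ => g (z + t * Complex.I)) g' 0) :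
    partialY f z = g' :=
  (hasDerivAt_line hfg h).deriv

/-- The directional derivative of the Eisenstein series as a function on `ℂ`. -/
def planeSeriesDeriv (k : ℤ) (v w s : ℂ) : ℂ :=
  v / (2 * Complex.I) * ((s + k) * planeSeries (k + 2) w (s - 1) - k / w.im * planeSeries k w s) +
    (starRingEnd ℂ) v * (Complex.I / (2 * w.im ^ 2)) * s * planeSeries (k - 2) w (s + 1)

theorem hasDerivAt_im_line (w v : ℂ) :
    HasDerivAt (fun t : ℝ => (((w + t * v).im : ℝ) : ℂ)) (v.im : ℂ) 0 := by
  have hlin : HasDerivAt (fun t : ℝ => w + t * v) v 0 := by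
    simpa using ((hasDerivAt_id (0 : ℝ)).ofReal_comp.mul_const v).const_add w
  have him : HasDerivAt (fun t : ℝ => (w + t * v).im) v.im 0 :=
    Complex.imCLM.hasFDerivAt.comp_hasDerivAt 0 hlin
  exact him.ofReal_comp

theorem hasDerivAt_planeSeriesDeriv (k : ℤ) {w : ℂ} (hw : 0 < w.im) {s : ℂ}
    (hs : 2 < 2 * s.re + (k : ℝ)) (v : ℂ) :
    HasDerivAt (fun t : ℝ => planeSeriesDeriv k v (w + t * v) s)
      (v / (2 * Complex.I) * ((s + k) * planeSeriesDeriv (k + 2) v w (s - 1)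
        - (-(k * v.im) / w.im ^ 2 * planeSeries k w s + k / w.im * planeSeriesDeriv k v w s)) +
      ((starRingEnd ℂ) v * (-(Complex.I * v.im) / w.im ^ 3) * s * planeSeries (k - 2) w (s + 1) +
      (starRingEnd ℂ) v * (Complex.I / (2 * w.im ^ 2)) * s *
        planeSeriesDeriv (k - 2) v w (s + 1))) 0 := by
  have hs1 : 2 < 2 * (s - 1).re + ((k + 2 : ℤ) : ℝ) := by
    push_cast; simp only [Complex.sub_re, Complex.one_re]; linarith
  have hs2 : 2 < 2 * (s + 1).re + ((k - 2 : ℤ) : ℝ) := by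
    push_cast; simp only [Complex.add_re, Complex.one_re]; linarith
  have hw' : (w.im : ℂ) ≠ 0 := by exact_mod_cast hw.ne'
  have d0 := hasDerivAt_planeSeries k hw hs v
  have d1 := hasDerivAt_planeSeries (k + 2) hw hs1 v
  have d2 := hasDerivAt_planeSeries (k - 2) hw hs2 v
  have him := hasDerivAt_im_line w v
  have hw0 : (((w + (0 : ℝ) * v).im : ℝ) : ℂ) ≠ 0 := by simpa using hw'
  have hinv : HasDerivAt (fun t : ℝ => (k : ℂ) / (((w + t * v).im : ℝ) : ℂ))
      (-(k * v.im) / w.im ^ 2) 0 := by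
    refine ((hasDerivAt_const (0 : ℝ) (k : ℂ)).div him hw0).congr_deriv ?_
    simp
  have hinv2 : HasDerivAt (fun t : ℝ => Complex.I / (2 * (((w + t * v).im : ℝ) : ℂ) ^ 2))
      (-(Complex.I * v.im) / w.im ^ 3) 0 := by
    refine ((hasDerivAt_const (0 : ℝ) Complex.I).div ((him.pow 2).const_mul 2)
      (mul_ne_zero two_ne_zero (pow_ne_zero 2 hw0))).congr_deriv ?_
    simp only [Complex.ofReal_zero, zero_mul, add_zero]
    field_simp
    simp
    ring
  refine ((((d1.const_mul (s + k)).sub (hinv.mul d0)).const_mul (v / (2 * Complex.I))).add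
    (((hinv2.const_mul ((starRingEnd ℂ) v)).mul_const s).mul d2)).congr_deriv ?_
  simp only [Complex.ofReal_zero, zero_mul, add_zero, planeSeriesDeriv]

/-- The Eisenstein series is an eigenfunction of the weight `k` Laplacian. -/
theorem laplacian_eisensteinSeries (k : ℤ) {s : ℂ} (hs : 2 < 2 * s.re + (k : ℝ))
    (z : UpperHalfPlane) :
    laplacian k (fun z => eisensteinSeries k z s) z = s * (s + k - 1) * eisensteinSeries k z s := by
  have hpos : ∀ z : UpperHalfPlane, 0 < (z : ℂ).im := fun z => z.im_pos
  have hX : ∀ z : UpperHalfPlane, partialX (fun z => eisensteinSeries k z s) z =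
      planeSeriesDeriv k 1 z s := fun z =>
    partialX_eq (g := fun w => planeSeries k w s) (fun z => eisensteinSeries_eq k z s) (hasDerivAt_planeSeries k (hpos z) hs 1)
  have hY : ∀ z : UpperHalfPlane, partialY (fun z => eisensteinSeries k z s) z =
      planeSeriesDeriv k Complex.I z s := fun z =>
    partialY_eq (g := fun w => planeSeries k w s) (fun z => eisensteinSeries_eq k z s)
      (hasDerivAt_planeSeries k (hpos z) hs Complex.I)
  have hXX := partialX_eq (g := fun w => planeSeriesDeriv k 1 w s) hX
    (hasDerivAt_planeSeriesDeriv k (hpos z) hs 1)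
  have hYY := partialY_eq (g := fun w => planeSeriesDeriv k Complex.I w s) hY
    (hasDerivAt_planeSeriesDeriv k (hpos z) hs Complex.I)
  have hy : ((z : ℂ).im : ℂ) ≠ 0 := by exact_mod_cast z.im_pos.ne'
  -- Since `1 ^ 2 + I ^ 2 = 0`, the pure Wirtinger derivatives `∂_z²` and `∂_z̄²` cancel in `∂x² +
  -- ∂y²`, and the weights `k ± 4` with them. There remain `4 y² ∂_z ∂_z̄` and `-2iky ∂_z̄`.
  rw [laplacian, hXX, hYY, hX, hY, eisensteinSeries_eq]
  simp only [planeSeriesDeriv, add_sub_cancel_right, sub_add_cancel, Complex.one_im,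
    Complex.I_im, map_one, Complex.conj_I, Complex.ofReal_zero, Complex.ofReal_one,
    UpperHalfPlane.coe_im] at hy ⊢
  push_cast
  generalize planeSeries (k + 2 + 2) _ _ = e₁
  generalize planeSeries (k + 2) _ _ = e₂
  generalize planeSeries k _ _ = e₃
  generalize planeSeries (k - 2) _ _ = e₄
  generalize planeSeries (k - 2 - 2) _ _ = e₅
  generalize (z.im : ℂ) = y at *
  have hI4 : Complex.I ^ 4 = 1 := Complex.I_pow_four
  have hI6 : Complex.I ^ 6 = -1 := by rw [show 6 = 4 + 2 by rfl, pow_add, hI4, Complex.I_sq]; ring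
  field_simp
  ring_nf
  simp only [Complex.I_sq, hI4, hI6]
  ring

/-- Right multiplication of `(m, n)` by `γ` permutes the nonzero lattice vectors. With `D = cz + d`,
both `Im γz` and `|m γz + n|²` acquire `|D|⁻²`, so their ratio is unaffected and only `D ^ k`
survives. -/
theorem eisensteinSeries_smul (k : ℤ) (γ : SL(2, ℤ)) (z : UpperHalfPlane) (s : ℂ) :
    eisensteinSeries k (γ • z) s =
      (((γ 1 0 : ℤ) : ℂ) * (z : ℂ) + ((γ 1 1 : ℤ) : ℂ)) ^ k * eisensteinSeries k z s := by
  have hdet : γ 0 0 * γ 1 1 - γ 0 1 * γ 1 0 = 1 := by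
    rw [← Matrix.det_fin_two, γ.det_coe]
  let e : ℤ × ℤ ≃ ℤ × ℤ :=
    { toFun := fun p => (p.1 * γ 0 0 + p.2 * γ 1 0, p.1 * γ 0 1 + p.2 * γ 1 1)
      invFun := fun p => (p.1 * γ 1 1 - p.2 * γ 1 0, -p.1 * γ 0 1 + p.2 * γ 0 0)
      left_inv := fun p => Prod.ext (by simp only; linear_combination p.1 * hdet)
        (by simp only; linear_combination p.2 * hdet)
      right_inv := fun p => Prod.ext (by simp only; linear_combination p.1 * hdet)
        (by simp only; linear_combination p.2 * hdet) }
  have he : ∀ p : ℤ × ℤ, p ≠ 0 ↔ e p ≠ 0 := fun p => by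
    have h0 : e 0 = 0 := by simp [e]
    rw [not_iff_not, ← e.injective.eq_iff, h0]
  let e' : {p : ℤ × ℤ // p ≠ 0} ≃ {p : ℤ × ℤ // p ≠ 0} := e.subtypeEquiv he
  have hD : ((γ 1 0 : ℤ) : ℂ) * (z : ℂ) + ((γ 1 1 : ℤ) : ℂ) ≠ 0 := by
    have := linear_ne_zero z.im_pos (p := (γ 1 0, γ 1 1)) fun h => by
      have h1 : γ 1 0 = 0 := congrArg Prod.fst h
      have h2 : γ 1 1 = 0 := congrArg Prod.snd h
      simp [h1, h2] at hdet
    exact this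
  set D := ((γ 1 0 : ℤ) : ℂ) * (z : ℂ) + ((γ 1 1 : ℤ) : ℂ) with hDdef
  have hden : UpperHalfPlane.denom γ z = D := by
    simp [UpperHalfPlane.denom, hDdef]
  have hterm : ∀ p : {p : ℤ × ℤ // p ≠ 0}, eisensteinTerm k (γ • z) s p.1 =
      D ^ k * eisensteinTerm k z s (e' p).1 := by
    intro p
    have hcoe : ((γ • z : UpperHalfPlane) : ℂ) =
        (((γ 0 0 : ℤ) : ℂ) * (z : ℂ) + ((γ 0 1 : ℤ) : ℂ)) / D := by
      rw [UpperHalfPlane.specialLinearGroup_apply]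
      simp [hDdef]
    have hlin : ((p.1.1 : ℂ) * ((γ • z : UpperHalfPlane) : ℂ) + (p.1.2 : ℂ)) =
        (((e' p).1.1 : ℂ) * z + ((e' p).1.2 : ℂ)) / D := by
      rw [hcoe, eq_div_iff hD]
      have : (((e' p).1.1 : ℂ) * z + ((e' p).1.2 : ℂ)) =
        (p.1.1 * γ 0 0 + p.1.2 * γ 1 0) * z + (p.1.1 * γ 0 1 + p.1.2 * γ 1 1) := by
        simp [e', e]
      rw [this, add_mul, mul_assoc, div_mul_cancel₀ _ hD]
      ring
    have him : ((γ • z : UpperHalfPlane) : ℂ).im = z.im / Complex.normSq D := by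
      rw [← hden]
      exact ModularGroup.im_smul_eq_div_normSq γ z
    have h1 := planeTerm_eq_exp k (γ • z).im_pos s p.2
    have h2 := planeTerm_eq_exp k z.im_pos s (e' p).2
    have hN : Complex.normSq D ≠ 0 := (Complex.normSq_pos.2 hD).ne'
    change planeTerm k _ s _ = D ^ k * planeTerm k _ s _
    rw [h1, h2, hlin, him, Complex.normSq_div,
      div_div_div_cancel_right₀ hN, div_zpow, zpow_neg D, div_inv_eq_mul, UpperHalfPlane.coe_im]
    ring
  rw [eisensteinSeries, eisensteinSeries, tsum_congr hterm, tsum_mul_left,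
    e'.tsum_eq (fun p => eisensteinTerm k z s p.1)]
  ring

end

/-! ### The lattice theta function and its inversion formula. -/

section

open Filter Topology

/-- The quadratic form `|mz+n|²/y`. -/
def latticeForm (z : UpperHalfPlane) (p : ℤ × ℤ) : ℝ :=
  Complex.normSq ((p.1 : ℂ) * (z : ℂ) + (p.2 : ℂ)) / z.im

theorem latticeForm_zero (z : UpperHalfPlane) : latticeForm z 0 = 0 := by simp [latticeForm]

theorem latticeForm_pos (z : UpperHalfPlane) {p : ℤ × ℤ} (hp : p ≠ 0) : 0 < latticeForm z p :=
  div_pos (Complex.normSq_pos.2 (linear_ne_zero z.im_pos hp)) z.im_pos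

theorem latticeForm_eq (z : UpperHalfPlane) (m n : ℤ) :
    latticeForm z (m, n) = ((m * z.re + n) ^ 2 + m ^ 2 * z.im ^ 2) / z.im := by
  simp [latticeForm, Complex.normSq_apply]
  ring

theorem exp_neg_le_factorial_div_pow (N : ℕ) {x : ℝ} (hx : 0 < x) :
    Real.exp (-x) ≤ N.factorial / x ^ N := by
  have h := Real.pow_div_factorial_le_exp x hx.le N
  rw [Real.exp_neg, ← inv_div]
  exact inv_anti₀ (by positivity) h

theorem summable_exp_latticeForm (z : UpperHalfPlane) {t : ℝ} (ht : 0 < t) :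
    Summable fun p : ℤ × ℤ => Complex.exp (-(Real.pi * t * latticeForm z p : ℝ)) := by
  have h4 : Summable fun p : ℤ × ℤ => ‖![p.1, p.2]‖ ^ (-(4 : ℝ)) := by
    have h := EisensteinSeries.summable_one_div_norm_rpow (k := 4) (by norm_num)
    rw [← (finTwoArrowEquiv ℤ).symm.summable_iff] at h
    exact h
  set c := stripConst |z.re| z.im with hc
  have hc0 : 0 < c := stripConst_pos _ _
  refine Summable.of_norm_bounded_eventually
    (h4.mul_left ((Nat.factorial 2 : ℝ) / (Real.pi * t / z.im * c ^ 2) ^ 2)) ?_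
  filter_upwards [(Set.finite_singleton (0 : ℤ × ℤ)).compl_mem_cofinite] with p hp
  have hp0 : p ≠ 0 := by simpa using hp
  have hn := norm_lattice_pos hp0
  have hQ : (c * ‖![p.1, p.2]‖) ^ 2 / z.im ≤ latticeForm z p := by
    rw [latticeForm, Complex.normSq_eq_norm_sq]
    have := stripConst_mul_le z.im_pos (w := z) le_rfl le_rfl hp0
    have hy := z.im_pos
    gcongr
    exact this
  have hQ0 := latticeForm_pos z hp0
  have hy := z.im_pos
  rw [← Complex.ofReal_neg, Complex.norm_exp_ofReal]
  refine (exp_neg_le_factorial_div_pow 2 (x := Real.pi * t * latticeForm z p)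
    (by positivity)).trans ?_
  calc ((Nat.factorial 2 : ℕ) : ℝ) / (Real.pi * t * latticeForm z p) ^ 2
      ≤ (Nat.factorial 2 : ℕ) / (Real.pi * t * ((c * ‖![p.1, p.2]‖) ^ 2 / z.im)) ^ 2 := by gcongr
    _ = (Nat.factorial 2 : ℕ) / (Real.pi * t / z.im * c ^ 2) ^ 2 * ‖![p.1, p.2]‖ ^ (-(4 : ℝ)) := by
      rw [Real.rpow_neg hn.le, show (4 : ℝ) = (4 : ℕ) by norm_num, Real.rpow_natCast]
      field_simp

/-- The theta function of the quadratic form `|mz+n|²/y`. -/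
def latticeTheta (z : UpperHalfPlane) (t : ℝ) : ℂ :=
  ∑' p : ℤ × ℤ, Complex.exp (-(Real.pi * t * latticeForm z p : ℝ))

/-- The general term of the theta function after Poisson summation in one variable. -/
def dualTerm (z : UpperHalfPlane) (t : ℝ) (m n : ℤ) : ℂ :=
  Complex.exp (-(Real.pi * t * m ^ 2 * z.im) - Real.pi * n ^ 2 * z.im / t +
    2 * Real.pi * Complex.I * n * m * z.re)

theorem summable_gaussian {a : ℝ} (ha : 0 < a) :
    Summable fun n : ℤ => Real.exp (-(Real.pi * n ^ 2 * a)) := by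
  have h := (summable_jacobiTheta₂_term_iff 0 (Complex.I * a)).2 (by simpa using ha)
  refine h.norm.congr fun n => ?_
  rw [norm_jacobiTheta₂_term]
  simp

theorem summable_dualTerm (z : UpperHalfPlane) {t : ℝ} (ht : 0 < t) :
    Summable fun p : ℤ × ℤ => dualTerm z t p.1 p.2 := by
  have h := (summable_gaussian (mul_pos ht z.im_pos)).mul_of_nonneg
    (summable_gaussian (div_pos z.im_pos ht)) (fun _ => (Real.exp_pos _).le)
    (fun _ => (Real.exp_pos _).le)
  refine Summable.of_norm_bounded h fun p => le_of_eq ?_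
  rw [dualTerm, ← Real.exp_add, Complex.norm_exp]
  congr 1
  have : (-(Real.pi * t * p.1 ^ 2 * z.im) - Real.pi * p.2 ^ 2 * z.im / t +
    2 * Real.pi * Complex.I * p.2 * p.1 * z.re : ℂ) =
    ((-(Real.pi * t * p.1 ^ 2 * z.im) - Real.pi * p.2 ^ 2 * z.im / t : ℝ) : ℂ) +
      ((2 * Real.pi * p.2 * p.1 * z.re : ℝ) : ℂ) * Complex.I := by
    push_cast
    ring
  rw [this, Complex.add_re, Complex.ofReal_re, Complex.re_ofReal_mul, Complex.I_re]
  ring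

/-- Poisson summation in `n` alone, with `m` fixed: the row is a Jacobi theta value with `τ = it/y`,
and its functional equation applies. -/
theorem tsum_exp_latticeForm_row (z : UpperHalfPlane) {t : ℝ} (ht : 0 < t) (m : ℤ) :
    ∑' n : ℤ, Complex.exp (-(Real.pi * t * latticeForm z (m, n) : ℝ)) =
      (((t / z.im) ^ (-(1 / 2) : ℝ) : ℝ) : ℂ) * ∑' n : ℤ, dualTerm z t m n := by
  have hy := z.im_pos
  have hy' : (z.im : ℂ) ≠ 0 := by exact_mod_cast hy.ne'
  have ht' : (t : ℂ) ≠ 0 := by exact_mod_cast ht.ne'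
  set τ : ℂ := Complex.I * t / z.im with hτ
  set ζ : ℂ := Complex.I * t * m * z.re / z.im with hζ
  have h1 : ∀ n : ℤ, Complex.exp (-(Real.pi * t * latticeForm z (m, n) : ℝ)) =
      Complex.exp (-(Real.pi * t * m ^ 2 * (z.re ^ 2 + z.im ^ 2) / z.im)) *
        jacobiTheta₂_term n ζ τ := by
    intro n
    rw [jacobiTheta₂_term, ← Complex.exp_add, latticeForm_eq, hτ, hζ]
    congr 1
    push_cast
    field_simp
    ring_nf
    simp only [Complex.I_sq]
    ring
  have h2 : ∀ n : ℤ, dualTerm z t m n = Complex.exp (-(Real.pi * t * m ^ 2 * z.im)) *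
      jacobiTheta₂_term n (ζ / τ) (-1 / τ) := by
    intro n
    rw [jacobiTheta₂_term, ← Complex.exp_add, dualTerm, hτ, hζ]
    congr 1
    field_simp
    ring
  have hIτ : -Complex.I * τ = ((t / z.im : ℝ) : ℂ) := by
    rw [hτ]
    push_cast
    field_simp
    simp
  have hpow : 1 / (-Complex.I * τ) ^ (1 / 2 : ℂ) = (((t / z.im) ^ (-(1 / 2) : ℝ) : ℝ) : ℂ) := by
    rw [hIτ, Real.rpow_neg (by positivity), Complex.ofReal_inv,
      Complex.ofReal_cpow (by positivity), one_div]
    push_cast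
    rfl
  rw [tsum_congr h1, tsum_congr h2, tsum_mul_left, tsum_mul_left]
  change _ * jacobiTheta₂ ζ τ = _ * (_ * jacobiTheta₂ (ζ / τ) (-1 / τ))
  rw [jacobiTheta₂_functional_equation, hpow]
  have hexp : Complex.exp (-(Real.pi * t * m ^ 2 * (z.re ^ 2 + z.im ^ 2) / z.im)) *
      Complex.exp (-Real.pi * Complex.I * ζ ^ 2 / τ) =
      Complex.exp (-(Real.pi * t * m ^ 2 * z.im)) := by
    rw [← Complex.exp_add, hτ, hζ]
    congr 1
    field_simp
    ring_nf
    simp only [Complex.I_sq]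
    ring
  rw [← hexp]
  ring

theorem latticeTheta_eq_dual (z : UpperHalfPlane) {t : ℝ} (ht : 0 < t) :
    latticeTheta z t = (((t / z.im) ^ (-(1 / 2) : ℝ) : ℝ) : ℂ) *
      ∑' p : ℤ × ℤ, dualTerm z t p.1 p.2 := by
  rw [latticeTheta, (summable_exp_latticeForm z ht).tsum_prod, (summable_dualTerm z ht).tsum_prod,
    ← tsum_mul_left]
  exact tsum_congr fun m => tsum_exp_latticeForm_row z ht m

/-- After one-variable summation the terms are symmetric: replacing `t` by `t⁻¹` amounts to
exchanging `m` and `n`. Only the prefactor `(t / y) ^ (-1/2)` changes, by the factor `t`. -/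
theorem latticeTheta_inv (z : UpperHalfPlane) {t : ℝ} (ht : 0 < t) :
    latticeTheta z t⁻¹ = t * latticeTheta z t := by
  have hy := z.im_pos
  rw [latticeTheta_eq_dual z ht, latticeTheta_eq_dual z (inv_pos.2 ht),
    ← (Equiv.prodComm ℤ ℤ).tsum_eq, ← mul_assoc, ← Complex.ofReal_mul]
  congr 1
  · norm_cast
    rw [Real.rpow_neg (by positivity), Real.rpow_neg (by positivity), ← Real.sqrt_eq_rpow,
      ← Real.sqrt_eq_rpow, Real.sqrt_div ht.le, Real.sqrt_div (by positivity), Real.sqrt_inv]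
    have h1 : Real.sqrt t ≠ 0 := (Real.sqrt_pos.2 ht).ne'
    have h2 : Real.sqrt z.im ≠ 0 := (Real.sqrt_pos.2 hy).ne'
    field_simp
    rw [Real.sq_sqrt ht.le]
  · refine tsum_congr fun p => ?_
    simp only [dualTerm, Equiv.prodComm_apply, Prod.fst_swap, Prod.snd_swap, Complex.ofReal_inv]
    congr 1
    rw [div_inv_eq_mul]
    ring

end

/-! ### Riemann's method: the Mellin transform of the theta function. -/

section

open Filter Topology MeasureTheory Set

/-- Tonelli for the norms gives finiteness of the integral; measurability of the sum comes from
finite partial sums. -/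
theorem integrable_tsum_of_summable_integral_norm {α ι : Type*} [MeasurableSpace α] {μ : Measure α}
    [Countable ι] {F : ι → α → ℂ} (hF : ∀ i, Integrable (F i) μ)
    (hsum : Summable fun i => ∫ a, ‖F i a‖ ∂μ) (hae : ∀ᵐ a ∂μ, Summable fun i => F i a) :
    Integrable (fun a => ∑' i, F i a) μ := by
  have hmeas : AEStronglyMeasurable (fun a => ∑' i, F i a) μ :=
    aestronglyMeasurable_of_tendsto_ae (u := (atTop : Filter (Finset ι)))
      (f := fun S a => ∑ i ∈ S, F i a)
      (fun S => Finset.aestronglyMeasurable_fun_sum S fun i _ => (hF i).1)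
      (hae.mono fun a ha => ha.hasSum)
  refine ⟨hmeas, ?_⟩
  have hle : ∫⁻ a, ‖∑' i, F i a‖ₑ ∂μ ≤ ∑' i, ∫⁻ a, ‖F i a‖ₑ ∂μ := by
    rw [← lintegral_tsum fun i => (hF i).1.enorm]
    exact lintegral_mono fun a => enorm_tsum_le_tsum_enorm
  refine lt_of_le_of_lt hle ?_
  have (i : ι) : ∫⁻ a, ‖F i a‖ₑ ∂μ = ENNReal.ofReal (∫ a, ‖F i a‖ ∂μ) := by
    rw [ofReal_integral_norm_eq_lintegral_enorm (hF i)]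
  simp_rw [this]
  rw [← ENNReal.ofReal_tsum_of_nonneg (fun i => integral_nonneg fun a => norm_nonneg _) hsum]
  exact ENNReal.ofReal_lt_top

theorem planeTerm_weight_zero (z : UpperHalfPlane) (s : ℂ) {p : ℤ × ℤ} (hp : p ≠ 0) :
    planeTerm 0 z s p = (latticeForm z p : ℂ) ^ (-s) := by
  have hQ := latticeForm_pos z hp
  rw [planeTerm_eq_exp 0 z.im_pos s hp, Complex.cpow_def_of_ne_zero (by exact_mod_cast hQ.ne'),
    ← Complex.ofReal_log hQ.le, latticeForm, ← inv_div, Real.log_inv]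
  simp
  ring_nf

theorem summable_latticeForm_rpow (z : UpperHalfPlane) {σ : ℝ} (hσ : 1 < σ) :
    Summable fun p : {p : ℤ × ℤ // p ≠ 0} => latticeForm z p.1 ^ (-σ) := by
  have h := (summable_planeTerm 0 z.im_pos (s := (σ : ℂ)) (by simp; linarith)).norm
  refine h.congr fun p => ?_
  rw [planeTerm_weight_zero z _ p.2, Complex.norm_cpow_eq_rpow_re_of_pos (latticeForm_pos z p.2)]
  simp

/-- The theta function without its constant term. -/
def latticeTheta₀ (z : UpperHalfPlane) (t : ℝ) : ℂ :=
  ∑' p : {p : ℤ × ℤ // p ≠ 0}, Complex.exp (-(Real.pi * t * latticeForm z p.1 : ℝ))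

theorem summable_exp_latticeForm_ne_zero (z : UpperHalfPlane) {t : ℝ} (ht : 0 < t) :
    Summable fun p : {p : ℤ × ℤ // p ≠ 0} =>
      Complex.exp (-(Real.pi * t * latticeForm z p.1 : ℝ)) :=
  (summable_exp_latticeForm z ht).subtype _

theorem latticeTheta₀_eq (z : UpperHalfPlane) {t : ℝ} (ht : 0 < t) :
    latticeTheta z t = latticeTheta₀ z t + 1 := by
  have h := (summable_exp_latticeForm z ht).sum_add_tsum_subtype_compl {(0 : ℤ × ℤ)}
  rw [Finset.sum_singleton, latticeForm_zero] at h
  have e : (∑' p : {p : ℤ × ℤ // p ∉ ({0} : Finset (ℤ × ℤ))},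
      Complex.exp (-(Real.pi * t * latticeForm z p.1 : ℝ))) = latticeTheta₀ z t :=
    (Equiv.subtypeEquivRight (p := fun p : ℤ × ℤ => p ∉ ({0} : Finset (ℤ × ℤ)))
      (q := fun p => p ≠ 0) (by simp)).tsum_eq
        (fun p => Complex.exp (-(Real.pi * t * latticeForm z p.1 : ℝ)))
  rw [latticeTheta, ← h, e]
  simp [add_comm]

theorem latticeTheta₀_inv (z : UpperHalfPlane) {t : ℝ} (ht : 0 < t) :
    latticeTheta₀ z t⁻¹ = t * latticeTheta₀ z t + t - 1 := by
  have h := latticeTheta_inv z ht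
  rw [latticeTheta₀_eq z ht, latticeTheta₀_eq z (inv_pos.2 ht)] at h
  linear_combination h

theorem integral_norm_mellin_term {q : ℝ} (hq : 0 < q) {s : ℂ} (hs : 0 < s.re) :
    IntegrableOn (fun t : ℝ => (t : ℂ) ^ (s - 1) * Complex.exp (-(Real.pi * t * q : ℝ))) (Ioi 0) ∧
    ∫ t in Ioi (0 : ℝ), ‖(t : ℂ) ^ (s - 1) * Complex.exp (-(Real.pi * t * q : ℝ))‖ =
      (1 / Real.pi) ^ s.re * Real.Gamma s.re * q ^ (-s.re) := by
  have hπ := Real.pi_pos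
  have hnorm : ∀ t ∈ Ioi (0 : ℝ), ‖(t : ℂ) ^ (s - 1) * Complex.exp (-(Real.pi * t * q : ℝ))‖ =
      t ^ (s.re - 1) * Real.exp (-(Real.pi * q * t)) := by
    intro t ht
    rw [norm_mul, Complex.norm_cpow_eq_rpow_re_of_pos ht, ← Complex.ofReal_neg,
      Complex.norm_exp_ofReal, Complex.sub_re, Complex.one_re]
    ring_nf
  have hint := Real.integral_rpow_mul_exp_neg_mul_Ioi hs (mul_pos hπ hq)
  have hpos : 0 < (1 / (Real.pi * q)) ^ s.re * Real.Gamma s.re :=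
    mul_pos (by positivity) (Real.Gamma_pos_of_pos hs)
  constructor
  · have hi : IntegrableOn (fun t : ℝ => t ^ (s.re - 1) * Real.exp (-(Real.pi * q * t))) (Ioi 0) :=
      Integrable.of_integral_ne_zero (by rw [hint]; exact hpos.ne')
    refine (integrable_norm_iff ?_).1 (hi.congr_fun (fun t ht => (hnorm t ht).symm)
      measurableSet_Ioi)
    refine ContinuousOn.aestronglyMeasurable (fun t ht => ?_) measurableSet_Ioi
    refine ContinuousAt.continuousWithinAt (ContinuousAt.mul
      (Complex.continuousAt_ofReal_cpow_const _ _ (Or.inr (ne_of_gt ht))) ?_)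
    fun_prop
  · rw [setIntegral_congr_fun measurableSet_Ioi hnorm, hint, one_div, one_div,
      Real.inv_rpow (by positivity), Real.inv_rpow hπ.le, Real.mul_rpow hπ.le hq.le,
      Real.rpow_neg hq.le]
    field_simp

theorem hasSum_mellin_latticeTheta₀ (z : UpperHalfPlane) {s : ℂ} (hs : 1 < s.re) :
    IntegrableOn (fun t : ℝ => (t : ℂ) ^ (s - 1) * latticeTheta₀ z t) (Ioi 0) ∧
    ∫ t in Ioi (0 : ℝ), (t : ℂ) ^ (s - 1) * latticeTheta₀ z t =
      (Real.pi : ℂ) ^ (-s) * Complex.Gamma s *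
        ∑' p : {p : ℤ × ℤ // p ≠ 0}, planeTerm 0 z s p.1 := by
  have hs0 : 0 < s.re := by linarith
  constructor
  · simp only [latticeTheta₀, ← tsum_mul_left]
    refine integrable_tsum_of_summable_integral_norm
      (fun p => (integral_norm_mellin_term (latticeForm_pos z p.2) hs0).1) ?_ ?_
    · refine ((summable_latticeForm_rpow z hs).mul_left
        ((1 / Real.pi) ^ s.re * Real.Gamma s.re)).congr fun p => ?_
      exact (integral_norm_mellin_term (latticeForm_pos z p.2) hs0).2.symm
    · filter_upwards [ae_restrict_mem measurableSet_Ioi] with t ht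
      exact (summable_exp_latticeForm_ne_zero z ht).mul_left _
  · have h := hasSum_mellin_pi_mul (a := fun _ : {p : ℤ × ℤ // p ≠ 0} => (1 : ℂ))
      (q := fun p => latticeForm z p.1) (F := latticeTheta₀ z) (s := s)
      (fun p => Or.inr (latticeForm_pos z p.2)) hs0 (fun t ht => ?_) ?_
    · simp only [mellin, smul_eq_mul] at h
      rw [← h.tsum_eq, ← tsum_mul_left]
      refine tsum_congr fun p => ?_
      rw [planeTerm_weight_zero z s p.2, Complex.cpow_neg (latticeForm z p.1 : ℂ) s]
      simp [div_eq_mul_inv]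
    · have hsum := (summable_exp_latticeForm_ne_zero z ht).hasSum
      refine hsum.congr_fun fun p => ?_
      push_cast
      ring_nf
    · refine (summable_latticeForm_rpow z hs).congr fun p => ?_
      rw [Real.rpow_neg (latticeForm_pos z p.2).le]
      simp

/-- The symmetric kernel `t^(s-1) + t^(-s)`. -/
def symmKernel (s : ℂ) (t : ℝ) : ℂ := (t : ℂ) ^ (s - 1) + (t : ℂ) ^ (-s)

/-- The kernel is at most `2 t ^ R` and the exponential at most `(R + 2)! / (t Re q) ^ (R + 2)`. The
two extra powers leave `t ^ (-2)` for the integral and at least a square of `(Re q)⁻¹` for the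
lattice sum. -/
theorem norm_symmKernel_mul_exp_le (R : ℕ) {s q : ℂ} (hs : |s.re| ≤ R) (hq : 0 < q.re) {t : ℝ}
    (ht : 1 < t) :
    ‖symmKernel s t * Complex.exp (-(Real.pi * t * q))‖ ≤
      2 * (R + 2).factorial * (q.re ^ (R + 2))⁻¹ * t ^ (-2 : ℝ) := by
  have ht0 : 0 < t := by linarith
  have h1 : ‖symmKernel s t‖ ≤ 2 * t ^ R := by
    refine (norm_add_le _ _).trans ?_
    rw [Complex.norm_cpow_eq_rpow_re_of_pos ht0, Complex.norm_cpow_eq_rpow_re_of_pos ht0,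
      ← Real.rpow_natCast, two_mul]
    have := abs_le.1 hs
    refine add_le_add (Real.rpow_le_rpow_of_exponent_le ht.le ?_)
      (Real.rpow_le_rpow_of_exponent_le ht.le ?_)
    · rw [Complex.sub_re, Complex.one_re]; linarith
    · rw [Complex.neg_re]; linarith
  have h2 : ‖Complex.exp (-(Real.pi * t * q))‖ ≤ (R + 2).factorial / (t * q.re) ^ (R + 2) := by
    rw [Complex.norm_exp]
    have e : (-(Real.pi * t * q) : ℂ).re = -(Real.pi * t * q.re) := by
      rw [Complex.neg_re, ← Complex.ofReal_mul, Complex.re_ofReal_mul]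
    rw [e]
    refine le_trans (Real.exp_le_exp.2 ?_) (exp_neg_le_factorial_div_pow (R + 2)
      (mul_pos ht0 hq))
    have := Real.pi_gt_three
    have h := mul_pos ht0 hq
    nlinarith
  rw [norm_mul]
  calc ‖symmKernel s t‖ * ‖Complex.exp (-(Real.pi * t * q))‖
      ≤ (2 * t ^ R) * ((R + 2).factorial / (t * q.re) ^ (R + 2)) :=
        mul_le_mul h1 h2 (norm_nonneg _) (by positivity)
    _ = _ := by
      rw [Real.rpow_neg ht0.le, show (2 : ℝ) = (2 : ℕ) by norm_num, Real.rpow_natCast, mul_pow,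
        pow_add t]
      field_simp

theorem integrableOn_rpow_neg_two : IntegrableOn (fun t : ℝ => t ^ (-2 : ℝ)) (Ioi 1) :=
  integrableOn_Ioi_rpow_of_lt (by norm_num) one_pos

theorem continuousOn_symmKernel_mul_exp (s q : ℂ) :
    ContinuousOn (fun t : ℝ => symmKernel s t * Complex.exp (-(Real.pi * t * q))) (Ioi 1) := by
  intro t ht
  have ht0 : t ≠ 0 := (one_pos.trans ht).ne'
  refine ContinuousAt.continuousWithinAt (ContinuousAt.mul (ContinuousAt.add
    (Complex.continuousAt_ofReal_cpow_const _ _ (Or.inr ht0))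
    (Complex.continuousAt_ofReal_cpow_const _ _ (Or.inr ht0))) ?_)
  fun_prop

/-- The symmetrised incomplete Gamma function. -/
def incompleteMellin (s q : ℂ) : ℂ :=
  ∫ t in Ioi (1 : ℝ), symmKernel s t * Complex.exp (-(Real.pi * t * q))

theorem integrableOn_symmKernel_mul_exp (s : ℂ) {q : ℂ} (hq : 0 < q.re) :
    IntegrableOn (fun t : ℝ => symmKernel s t * Complex.exp (-(Real.pi * t * q))) (Ioi 1) := by
  obtain ⟨R, hR⟩ := exists_nat_ge |s.re|
  refine Integrable.mono' (integrableOn_rpow_neg_two.const_mul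
    (2 * (R + 2).factorial * (q.re ^ (R + 2))⁻¹))
    ((continuousOn_symmKernel_mul_exp s q).aestronglyMeasurable measurableSet_Ioi) ?_
  filter_upwards [ae_restrict_mem measurableSet_Ioi] with t ht
  exact norm_symmKernel_mul_exp_le R hR hq ht

theorem integral_norm_symmKernel_le (R : ℕ) {s q : ℂ} (hs : |s.re| ≤ R) (hq : 0 < q.re) :
    ∫ t in Ioi (1 : ℝ), ‖symmKernel s t * Complex.exp (-(Real.pi * t * q))‖ ≤
      2 * (R + 2).factorial * (q.re ^ (R + 2))⁻¹ := by
  refine (setIntegral_mono_on (integrableOn_symmKernel_mul_exp s hq).norm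
    (integrableOn_rpow_neg_two.const_mul (2 * (R + 2).factorial * (q.re ^ (R + 2))⁻¹))
    measurableSet_Ioi fun t ht => norm_symmKernel_mul_exp_le R hs hq ht).trans (le_of_eq ?_)
  rw [integral_const_mul, integral_Ioi_rpow_of_lt (by norm_num) one_pos]
  norm_num

theorem norm_incompleteMellin_le (R : ℕ) {s q : ℂ} (hs : |s.re| ≤ R) (hq : 0 < q.re) :
    ‖incompleteMellin s q‖ ≤ 2 * (R + 2).factorial * (q.re ^ (R + 2))⁻¹ :=
  (norm_integral_le_integral_norm _).trans (integral_norm_symmKernel_le R hs hq)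

theorem tsum_incompleteMellin (z : UpperHalfPlane) (s : ℂ) :
    ∑' p : {p : ℤ × ℤ // p ≠ 0}, incompleteMellin s (latticeForm z p.1) =
      ∫ t in Ioi (1 : ℝ), symmKernel s t * latticeTheta₀ z t := by
  obtain ⟨R, hR⟩ := exists_nat_ge |s.re|
  have hre : ∀ p : {p : ℤ × ℤ // p ≠ 0}, 0 < ((latticeForm z p.1 : ℝ) : ℂ).re := fun p => by
    simpa using latticeForm_pos z p.2
  have h := integral_tsum_of_summable_integral_norm (μ := volume.restrict (Ioi (1 : ℝ)))
    (F := fun (p : {p : ℤ × ℤ // p ≠ 0}) (t : ℝ) =>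
      symmKernel s t * Complex.exp (-(Real.pi * t * (latticeForm z p.1 : ℂ))))
    (fun p => integrableOn_symmKernel_mul_exp s (hre p)) ?_
  · rw [show (fun p : {p : ℤ × ℤ // p ≠ 0} => incompleteMellin s (latticeForm z p.1)) =
      fun p : {p : ℤ × ℤ // p ≠ 0} => ∫ t in Ioi (1 : ℝ), symmKernel s t *
        Complex.exp (-(Real.pi * t * (latticeForm z p.1 : ℂ))) from rfl, h]
    refine setIntegral_congr_fun measurableSet_Ioi fun t ht => ?_
    simp only [latticeTheta₀, tsum_mul_left]
    push_cast
    rfl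
  · refine Summable.of_nonneg_of_le (fun p => integral_nonneg fun t => norm_nonneg _)
      (fun p => integral_norm_symmKernel_le R hR (hre p))
      (((summable_latticeForm_rpow z (σ := ((R + 2 : ℕ) : ℝ)) (by
        push_cast; linarith [Nat.cast_nonneg (α := ℝ) R])).mul_left
          (2 * ((R + 2).factorial : ℝ))).congr fun p => ?_)
    rw [Real.rpow_neg (latticeForm_pos z p.2).le, Real.rpow_natCast, Complex.ofReal_re]

/-- Substitute `t ↦ t⁻¹` and use `latticeTheta₀_inv`. The change of variables needs no convergence,
so `s` is unrestricted. -/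
theorem integral_Ioc_mellin_latticeTheta₀ (z : UpperHalfPlane) (s : ℂ) :
    ∫ t in Ioc (0 : ℝ) 1, (t : ℂ) ^ (s - 1) * latticeTheta₀ z t =
      ∫ t in Ioi (1 : ℝ), ((t : ℂ) ^ (-s) * latticeTheta₀ z t + ((t : ℂ) ^ (-s)
        - (t : ℂ) ^ (-s - 1))) := by
  have himg : (fun t : ℝ => t⁻¹) '' Ioi 1 = Ioo 0 1 := by
    ext t
    simp only [mem_image, mem_Ioi, mem_Ioo]
    constructor
    · rintro ⟨u, hu, rfl⟩
      exact ⟨by positivity, inv_lt_one_of_one_lt₀ hu⟩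
    · rintro ⟨h0, h1⟩
      exact ⟨t⁻¹, (one_lt_inv₀ h0).2 h1, inv_inv t⟩
  rw [integral_Ioc_eq_integral_Ioo, ← himg, integral_image_eq_integral_abs_deriv_smul
    measurableSet_Ioi (f' := fun t => -(t ^ 2)⁻¹)
    (fun t ht => (hasDerivAt_inv (one_pos.trans ht).ne').hasDerivWithinAt) inv_injective.injOn]
  refine setIntegral_congr_fun measurableSet_Ioi fun t ht => ?_
  have ht0 : 0 < t := one_pos.trans ht
  have htc : (t : ℂ) ≠ 0 := by exact_mod_cast ht0.ne'
  simp only [abs_neg, abs_inv, abs_pow, abs_of_pos ht0, Complex.real_smul]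
  rw [latticeTheta₀_inv z ht0, Complex.ofReal_inv t, Complex.inv_cpow _ _ (by
    rw [Complex.arg_ofReal_of_nonneg ht0.le]; exact Real.pi_pos.ne), ← Complex.cpow_neg, neg_sub,
    sub_eq_add_neg 1 s, sub_eq_add_neg (-s) 1, Complex.cpow_add _ _ htc, Complex.cpow_add _ _ htc,
    Complex.cpow_neg_one, Complex.cpow_one]
  push_cast
  field_simp
  ring

/-- Splitting at `t = 1` and folding `(0, 1]` onto `(1, ∞)` produces the symmetric kernel. The
elementary leftover `∫ (t ^ (-s) - t ^ (-s - 1))` is `1 / (s - 1) - 1 / s`. -/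
theorem completed_eq_incompleteMellin (z : UpperHalfPlane) {s : ℂ} (hs : 1 < s.re) :
    (Real.pi : ℂ) ^ (-s) * Complex.Gamma s * ∑' p : {p : ℤ × ℤ // p ≠ 0}, planeTerm 0 z s p.1 =
      ∑' p : {p : ℤ × ℤ // p ≠ 0}, incompleteMellin s (latticeForm z p.1) +
        1 / (s - 1) - 1 / s := by
  obtain ⟨hint, heq⟩ := hasSum_mellin_latticeTheta₀ z hs
  have hI1 := hint.mono_set (Ioi_subset_Ioi zero_le_one)
  -- For `t > 1` it is dominated by the Mellin integrand, because `-Re s ≤ Re s - 1`.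
  have hI2 : IntegrableOn (fun t : ℝ => (t : ℂ) ^ (-s) * latticeTheta₀ z t) (Ioi 1) := by
    have hmeas : AEStronglyMeasurable (fun t : ℝ => (t : ℂ) ^ (-s) * latticeTheta₀ z t)
        (volume.restrict (Ioi 1)) := by
      have hc : ContinuousOn (fun t : ℝ => (t : ℂ) ^ (-s - (s - 1))) (Ioi 1) := fun t ht =>
        (Complex.continuousAt_ofReal_cpow_const _ _
          (Or.inr (one_pos.trans ht).ne')).continuousWithinAt
      refine ((hc.aestronglyMeasurable measurableSet_Ioi).mul hI1.1).congr ?_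
      filter_upwards [ae_restrict_mem measurableSet_Ioi] with t ht
      have htc : (t : ℂ) ≠ 0 := by exact_mod_cast (one_pos.trans ht).ne'
      simp only [Pi.mul_apply]
      rw [← mul_assoc, ← Complex.cpow_add _ _ htc, sub_add_cancel]
    refine hI1.norm.mono' hmeas ?_
    filter_upwards [ae_restrict_mem measurableSet_Ioi] with t ht
    have ht1 : 1 < t := ht
    rw [norm_mul, norm_mul, Complex.norm_cpow_eq_rpow_re_of_pos (by linarith),
      Complex.norm_cpow_eq_rpow_re_of_pos (by linarith)]
    refine mul_le_mul_of_nonneg_right (Real.rpow_le_rpow_of_exponent_le ht1.le ?_) (norm_nonneg _)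
    rw [Complex.neg_re, Complex.sub_re, Complex.one_re]
    linarith
  have hs1 : (-s).re < -1 := by rw [Complex.neg_re]; linarith
  have hs2 : (-s - 1).re < -1 := by
    rw [Complex.sub_re, Complex.neg_re, Complex.one_re]; linarith
  have hp1 := integrableOn_Ioi_cpow_of_lt hs1 one_pos
  have hp2 := integrableOn_Ioi_cpow_of_lt hs2 one_pos
  have hsne : s ≠ 0 := fun h => by simp [h] at hs; linarith
  have hsne1 : s - 1 ≠ 0 := fun h => by simp [sub_eq_zero.1 h] at hs
  have hsne2 : -s + 1 ≠ 0 := fun h => hsne1 (by linear_combination -h)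
  have hsplit := integral_add hI2 (hp1.sub hp2)
  simp only [Pi.sub_apply] at hsplit
  rw [← heq, ← Ioc_union_Ioi_eq_Ioi zero_le_one, setIntegral_union Ioc_disjoint_Ioi_same
    measurableSet_Ioi (hint.mono_set Ioc_subset_Ioi_self) hI1, integral_Ioc_mellin_latticeTheta₀,
    hsplit, integral_sub hp1 hp2, integral_Ioi_cpow_of_lt hs1 one_pos,
    integral_Ioi_cpow_of_lt hs2 one_pos, tsum_incompleteMellin]
  simp only [symmKernel, add_mul]
  rw [integral_add hI1 hI2]
  simp only [Complex.ofReal_one, Complex.one_cpow, sub_add_cancel]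
  field_simp
  ring

/-- The extra factor `s (s - 1)` of the double completion removes both poles: it turns `1 / (s - 1)
- 1 / s` into `1`. -/
theorem doublyCompletedSeries_zero (z : UpperHalfPlane) {s : ℂ} (hs : 1 < s.re) :
    doublyCompletedSeries 0 z s = 1 / 2 + 1 / 2 * (s * (s - 1) *
      ∑' p : {p : ℤ × ℤ // p ≠ 0}, incompleteMellin s (latticeForm z p.1)) := by
  have h := completed_eq_incompleteMellin z hs
  have hsne : s ≠ 0 := fun h => by simp [h] at hs; linarith
  have hsne1 : s - 1 ≠ 0 := fun h => by simp [sub_eq_zero.1 h] at hs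
  rw [doublyCompletedSeries, eisensteinSeries_eq, planeSeries]
  simp only [Int.cast_zero, zero_div, add_zero, sub_zero, abs_zero]
  rw [show s * (s - 1) * (Real.pi : ℂ) ^ (-s) * Complex.Gamma s *
    (1 / 2 * ∑' p : {p : ℤ × ℤ // p ≠ 0}, planeTerm 0 z s p.1) = 1 / 2 * (s * (s - 1)) *
      ((Real.pi : ℂ) ^ (-s) * Complex.Gamma s *
        ∑' p : {p : ℤ × ℤ // p ≠ 0}, planeTerm 0 z s p.1) by ring, h]
  field_simp
  ring

end

/-! ### The weight zero continuation on the complex tube. -/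

section

open Filter Topology MeasureTheory Metric

/-- A locally uniformly dominated series of holomorphic functions of several variables is
holomorphic. -/
theorem differentiableOn_tsum_of_locally_bounded {E ι : Type*} [NormedAddCommGroup E]
    [NormedSpace ℂ E] {F : ι → E → ℂ} {U : Set E} (hF : ∀ i, DifferentiableOn ℂ (F i) U)
    (hbound : ∀ x ∈ U, ∃ ε > 0, ball x ε ⊆ U ∧ ∃ u : ι → ℝ, Summable u ∧
      ∀ i, ∀ y ∈ ball x ε, ‖F i y‖ ≤ u i) :
    DifferentiableOn ℂ (fun x => ∑' i, F i x) U := by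
  intro x hx
  obtain ⟨ε, hε, hεU, u, hu, h⟩ := hbound x hx
  let _ : NormedSpace ℝ E := NormedSpace.restrictScalars ℝ ℂ E
  have hsub : ∀ y ∈ ball x (ε / 2), ball y (ε / 2) ⊆ ball x ε := fun y hy =>
    ball_subset_ball' (by rw [mem_ball] at hy; linarith)
  refine (hasFDerivAt_tsum_of_isPreconnected (u := fun i => 2 * u i / (ε / 2)) ?_ isOpen_ball
    (convex_ball x (ε / 2)).isPreconnected (f' := fun i y => fderiv ℂ (F i) y) ?_ ?_
    (mem_ball_self (half_pos hε)) ?_ (mem_ball_self (half_pos hε))).differentiableAt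
      |>.differentiableWithinAt
  · exact (hu.mul_left 2).div_const _
  · intro i y hy
    exact ((hF i).differentiableAt (mem_of_superset (isOpen_ball.mem_nhds
      (ball_subset_ball (by linarith) hy)) hεU)).hasFDerivAt
  · intro i y hy
    exact norm_fderiv_le_of_norm_le_on_ball (half_pos hε)
      ((hF i).mono ((hsub y hy).trans hεU)) fun w hw => h i w (hsub y hy hw)
  · exact Summable.of_norm_bounded hu fun i => h i x (mem_ball_self hε)

/-- The form `((mX+n)² + m²Y²)/Y` in complexified coordinates. -/
def complexForm (p : ℤ × ℤ) (q : ℂ × ℂ × ℂ) : ℂ :=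
  ((p.1 : ℂ) * q.1 + (p.2 : ℂ)) ^ 2 / q.2.1 + (p.1 : ℂ) ^ 2 * q.2.1

theorem complexForm_ofReal (p : ℤ × ℤ) (z : UpperHalfPlane) (s : ℂ) :
    complexForm p ((z.re : ℂ), (z.im : ℂ), s) = (latticeForm z p : ℂ) := by
  have hy : (z.im : ℂ) ≠ 0 := by exact_mod_cast z.im_pos.ne'
  rw [show p = (p.1, p.2) from rfl, latticeForm_eq, complexForm]
  push_cast
  field_simp

/-- The aperture `1/4` of the tube is small enough that complexifying `x` and `y` costs at most half
of the real form. Hence every Gaussian in the theta series still decays. -/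
theorem le_re_complexForm (p : ℤ × ℤ) {q : ℂ × ℂ × ℂ} (hq : q ∈ complexTube) :
    1 / 2 * ‖(p.1 : ℂ) * (⟨q.1.re, q.2.1.re⟩ : ℂ) + (p.2 : ℂ)‖ ^ 2 / q.2.1.re ≤
      (complexForm p q).re := by
  have hP := re_pos_of_mem_complexTube hq
  obtain ⟨h1, h2⟩ := hq
  set P := q.2.1.re with hPdef
  set η := q.2.1.im with hη
  set ξ := q.1.im with hξ
  set m : ℝ := (p.1 : ℝ) with hm
  set a : ℝ := m * q.1.re + p.2 with ha
  have hnorm : ‖(p.1 : ℂ) * (⟨q.1.re, P⟩ : ℂ) + (p.2 : ℂ)‖ ^ 2 = a ^ 2 + m ^ 2 * P ^ 2 := by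
    rw [← Complex.normSq_eq_norm_sq, Complex.normSq_apply]
    simp [ha, hm]
    ring
  have hre : (complexForm p q).re =
      ((a ^ 2 - m ^ 2 * ξ ^ 2) * P + 2 * a * m * ξ * η) / (P ^ 2 + η ^ 2) + m ^ 2 * P := by
    rw [complexForm, Complex.add_re, Complex.div_re, Complex.normSq_apply]
    simp only [pow_two, Complex.mul_re, Complex.mul_im, Complex.add_re, Complex.add_im,
      Complex.intCast_re, Complex.intCast_im, zero_mul, sub_zero, add_zero, ← hPdef, ← hη, ← hξ,
      ← hm, ← ha, mul_zero]
    ring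
  have hξ2 : ξ ^ 2 ≤ P ^ 2 / 16 := by
    have := sq_le_sq' (by linarith [abs_le.1 h1.le]) (abs_le.1 h1.le).2
    linarith [this]
  have hη2 : η ^ 2 ≤ P ^ 2 / 16 := by
    have := sq_le_sq' (by linarith [abs_le.1 h2.le]) (abs_le.1 h2.le).2
    linarith [this]
  have hcross : -(P / 4 * (a ^ 2 + m ^ 2 * ξ ^ 2)) ≤ 2 * a * m * ξ * η := by
    have e1 : |2 * a * m * ξ| ≤ a ^ 2 + m ^ 2 * ξ ^ 2 := by
      rw [abs_le]
      constructor <;> nlinarith [sq_nonneg (a + m * ξ), sq_nonneg (a - m * ξ)]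
    have e2 : |2 * a * m * ξ * η| ≤ P / 4 * (a ^ 2 + m ^ 2 * ξ ^ 2) := by
      rw [abs_mul, mul_comm]
      exact mul_le_mul h2.le e1 (abs_nonneg _) (by positivity)
    exact (abs_le.1 e2).1
  -- The loss `1/2 m² P` allowed here is repaid by the summand `m² P` coming from `m² Y`.
  have hmain : 1 / 2 * a ^ 2 / P - 1 / 2 * m ^ 2 * P ≤
      ((a ^ 2 - m ^ 2 * ξ ^ 2) * P + 2 * a * m * ξ * η) / (P ^ 2 + η ^ 2) := by
    rw [le_div_iff₀ (by positivity)]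
    have e3 : 1 / 2 * a ^ 2 / P * (P ^ 2 + η ^ 2) ≤ 1 / 2 * a ^ 2 / P * (17 / 16 * P ^ 2) := by
      gcongr
      linarith
    have e4 : 1 / 2 * a ^ 2 / P * (17 / 16 * P ^ 2) = 17 / 32 * a ^ 2 * P := by
      field_simp
      ring
    have e5 : m ^ 2 * ξ ^ 2 * P ≤ m ^ 2 * (P ^ 2 / 16) * P := by gcongr
    have e6 : 0 ≤ m ^ 2 * P * η ^ 2 := by positivity
    have e7 : 0 ≤ m ^ 2 * P ^ 3 := by positivity
    have e8 : 0 ≤ a ^ 2 * P := by positivity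
    nlinarith
  rw [hnorm, hre]
  have e9 : 1 / 2 * (a ^ 2 + m ^ 2 * P ^ 2) / P = 1 / 2 * a ^ 2 / P + 1 / 2 * m ^ 2 * P := by
    field_simp
  rw [e9]
  linarith

theorem re_complexForm_pos {p : ℤ × ℤ} (hp : p ≠ 0) {q : ℂ × ℂ × ℂ} (hq : q ∈ complexTube) :
    0 < (complexForm p q).re := by
  have hP := re_pos_of_mem_complexTube hq
  refine lt_of_lt_of_le ?_ (le_re_complexForm p hq)
  have := norm_pos_iff.2 (linear_ne_zero (w := ⟨q.1.re, q.2.1.re⟩) hP hp)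
  positivity

theorem differentiableOn_complexForm (p : ℤ × ℤ) :
    DifferentiableOn ℂ (complexForm p) complexTube := by
  have hne : ∀ q ∈ complexTube, q.2.1 ≠ 0 := fun q hq h => by
    have := re_pos_of_mem_complexTube hq
    simp [h] at this
  have hinv : DifferentiableOn ℂ (fun q : ℂ × ℂ × ℂ => q.2.1⁻¹) complexTube :=
    DifferentiableOn.inv (by fun_prop) hne
  have h1 : DifferentiableOn ℂ (fun q : ℂ × ℂ × ℂ => ((p.1 : ℂ) * q.1 + (p.2 : ℂ)) ^ 2)
      complexTube := by fun_prop
  have h2 : DifferentiableOn ℂ (fun q : ℂ × ℂ × ℂ => (p.1 : ℂ) ^ 2 * q.2.1) complexTube := by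
    fun_prop
  exact (h1.mul hinv).add h2

theorem differentiableOn_incompleteMellin {p : ℤ × ℤ} (hp : p ≠ 0) :
    DifferentiableOn ℂ (fun q : ℂ × ℂ × ℂ => incompleteMellin q.2.2 (complexForm p q))
      complexTube := by
  refine differentiableOn_integral_of_locally_bounded (fun q hq =>
    (continuousOn_symmKernel_mul_exp _ _).aestronglyMeasurable measurableSet_Ioi) fun q hq => ?_
  obtain ⟨R, hR⟩ := exists_nat_gt |q.2.2.re|
  have hpos := re_complexForm_pos hp hq
  have hc : ContinuousAt (fun q => (complexForm p q).re) q :=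
    Complex.continuous_re.continuousAt.comp
      ((differentiableOn_complexForm p).continuousOn.continuousAt (isOpen_complexTube.mem_nhds hq))
  have hev1 := hc.eventually (lt_mem_nhds (half_lt_self hpos))
  have hev2 : ∀ᶠ q' : ℂ × ℂ × ℂ in 𝓝 q, |q'.2.2.re| < R := by
    have : ContinuousAt (fun q' : ℂ × ℂ × ℂ => |q'.2.2.re|) q := by fun_prop
    exact this.eventually (gt_mem_nhds hR)
  obtain ⟨ε, hε, h⟩ := Metric.eventually_nhds_iff_ball.1
    ((hev1.and hev2).and (isOpen_complexTube.mem_nhds hq))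
  refine ⟨ε, hε, fun q' hq' => (h q' hq').2, fun t => 2 * (R + 2).factorial *
    (((complexForm p q).re / 2) ^ (R + 2))⁻¹ * t ^ (-2 : ℝ),
    integrableOn_rpow_neg_two.const_mul _, ?_⟩
  filter_upwards [ae_restrict_mem measurableSet_Ioi] with t ht
  have ht1 : 1 < t := ht
  have htc : (t : ℂ) ≠ 0 := by exact_mod_cast (one_pos.trans ht1).ne'
  refine ⟨?_, fun q' hq' => ?_⟩
  · have hf := (differentiableOn_complexForm p).mono fun q' hq' => (h q' hq').2
    refine DifferentiableOn.mul ?_ ((hf.const_mul _).neg.cexp)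
    refine Differentiable.differentiableOn fun q' => ?_
    exact (DifferentiableAt.const_cpow (by fun_prop) (Or.inl htc)).add
      (DifferentiableAt.const_cpow (by fun_prop) (Or.inl htc))
  · obtain ⟨⟨h1, h2⟩, h3⟩ := h q' hq'
    refine (norm_symmKernel_mul_exp_le R h2.le ((half_pos hpos).trans h1) ht1).trans ?_
    have : 0 < (complexForm p q).re / 2 := half_pos hpos
    have ht2 : 0 ≤ t ^ (-2 : ℝ) := Real.rpow_nonneg (by linarith) _
    gcongr

/-- Combines the decay of `incompleteMellin` in `Re q` with the strip bound for the form. The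
lattice exponent is `2 (R + 2) ≥ 4`, hence summable, and `Re Y ^ (R + 2)` gives polynomial growth.
-/
theorem norm_incompleteMellin_complexForm_le (A : ℝ) {B : ℝ} (hB : 0 < B) (R : ℕ) :
    ∃ C : ℝ, 0 ≤ C ∧ ∀ q ∈ complexTube, |q.1.re| ≤ A → B ≤ q.2.1.re → |q.2.2.re| ≤ R →
      ∀ p : {p : ℤ × ℤ // p ≠ 0}, ‖incompleteMellin q.2.2 (complexForm p.1 q)‖ ≤
        C * q.2.1.re ^ (R + 2) * ‖![p.1.1, p.1.2]‖ ^ (-((2 * (R + 2) : ℕ) : ℝ)) := by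
  have hc := stripConst_pos A B
  refine ⟨2 * (R + 2).factorial * (2 / stripConst A B ^ 2) ^ (R + 2), by positivity,
    fun q hq hA hBq hR p => ?_⟩
  have hP := re_pos_of_mem_complexTube hq
  have hn := norm_lattice_pos p.2
  have hlow : 1 / 2 * (stripConst A B * ‖![p.1.1, p.1.2]‖) ^ 2 / q.2.1.re ≤
      (complexForm p.1 q).re := by
    refine le_trans ?_ (le_re_complexForm p.1 hq)
    have := stripConst_mul_le hB (w := ⟨q.1.re, q.2.1.re⟩) hA hBq p.2
    gcongr
  refine (norm_incompleteMellin_le R hR (re_complexForm_pos p.2 hq)).trans ?_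
  calc 2 * ((R + 2).factorial : ℝ) * ((complexForm p.1 q).re ^ (R + 2))⁻¹
      ≤ 2 * ((R + 2).factorial : ℝ) *
        ((1 / 2 * (stripConst A B * ‖![p.1.1, p.1.2]‖) ^ 2 / q.2.1.re) ^ (R + 2))⁻¹ := by gcongr
    _ = _ := by
      have e : (1 / 2 * (stripConst A B * ‖![p.1.1, p.1.2]‖) ^ 2 / q.2.1.re)⁻¹ =
          2 / stripConst A B ^ 2 * q.2.1.re * (‖![p.1.1, p.1.2]‖ ^ 2)⁻¹ := by
        field_simp
      rw [Real.rpow_neg hn.le, Real.rpow_natCast, pow_mul, ← inv_pow, ← inv_pow, e, mul_pow,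
        mul_pow]
      ring

/-- The continuation of the completed weight zero Eisenstein series in complexified
coordinates. -/
def weightZeroContinuation (q : ℂ × ℂ × ℂ) : ℂ :=
  1 / 2 + 1 / 2 * (q.2.2 * (q.2.2 + -1) *
    ∑' p : {p : ℤ × ℤ // p ≠ 0}, incompleteMellin q.2.2 (complexForm p.1 q))

theorem summable_latticeNorm_natCast (R : ℕ) : Summable fun p : {p : ℤ × ℤ // p ≠ 0} =>
    ‖![p.1.1, p.1.2]‖ ^ (-((2 * (R + 2) : ℕ) : ℝ)) :=
  summable_latticeNorm (by push_cast; linarith [Nat.cast_nonneg (α := ℝ) R])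

theorem isTame_tsum_incompleteMellin : IsTame fun q =>
    ∑' p : {p : ℤ × ℤ // p ≠ 0}, incompleteMellin q.2.2 (complexForm p.1 q) := by
  constructor
  · refine differentiableOn_tsum_of_locally_bounded
      (fun p => differentiableOn_incompleteMellin p.2) fun q hq => ?_
    obtain ⟨R, hR⟩ := exists_nat_gt |q.2.2.re|
    have hP := re_pos_of_mem_complexTube hq
    obtain ⟨C, hC, h⟩ := norm_incompleteMellin_complexForm_le (|q.1.re| + 1) (half_pos hP) R
    have hev1 : ∀ᶠ q' : ℂ × ℂ × ℂ in 𝓝 q, |q'.1.re| < |q.1.re| + 1 := by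
      have : ContinuousAt (fun q' : ℂ × ℂ × ℂ => |q'.1.re|) q := by fun_prop
      exact this.eventually (gt_mem_nhds (lt_add_one _))
    have hev2 : ∀ᶠ q' : ℂ × ℂ × ℂ in 𝓝 q, |q'.2.2.re| < R := by
      have : ContinuousAt (fun q' : ℂ × ℂ × ℂ => |q'.2.2.re|) q := by fun_prop
      exact this.eventually (gt_mem_nhds hR)
    have hcY : ContinuousAt (fun q' : ℂ × ℂ × ℂ => q'.2.1.re) q := by fun_prop
    have hev3 := hcY.eventually (lt_mem_nhds (half_lt_self hP))
    have hev4 := hcY.eventually (gt_mem_nhds (lt_add_one q.2.1.re))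
    obtain ⟨ε, hε, hb⟩ := Metric.eventually_nhds_iff_ball.1
      ((hev1.and hev2).and ((hev3.and hev4).and (isOpen_complexTube.mem_nhds hq)))
    refine ⟨ε, hε, fun q' hq' => (hb q' hq').2.2, _,
      (summable_latticeNorm_natCast R).mul_left (C * (q.2.1.re + 1) ^ (R + 2)),
      fun p q' hq' => ?_⟩
    obtain ⟨⟨h1, h2⟩, ⟨h3, h4⟩, h5⟩ := hb q' hq'
    refine (h q' h5 h1.le h3.le h2.le p).trans ?_
    have := re_pos_of_mem_complexTube h5
    gcongr
  · intro A R
    -- The bounds `A + 1`, `1/2` and `R'` leave room for moving each coordinate by `1/8` off the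
    -- real point.
    obtain ⟨R', hR'⟩ := exists_nat_ge (R + 1)
    obtain ⟨C, hC, h⟩ := norm_incompleteMellin_complexForm_le (A + 1)
      (show (0 : ℝ) < 1 / 2 by norm_num) R'
    refine ⟨1 / 8, by norm_num, le_rfl, C * 2 ^ (R' + 2) * ∑' p : {p : ℤ × ℤ // p ≠ 0},
      ‖![p.1.1, p.1.2]‖ ^ (-((2 * (R' + 2) : ℕ) : ℝ)), R' + 2, fun x y s hx hy hs q hq => ?_⟩
    have htube := ball_subset_complexTube le_rfl hy hq
    obtain ⟨e1, -, e3, -⟩ := re_im_close hq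
    have e4 := (coord_close hq).2.2
    have hA : |q.1.re| ≤ A + 1 := by
      have := abs_add_le (q.1.re - x) x
      rw [sub_add_cancel] at this
      linarith
    have hs' : |q.2.2.re| ≤ R' := by
      have h1 := norm_add_le (q.2.2 - s) s
      rw [sub_add_cancel] at h1
      have := Complex.abs_re_le_norm q.2.2
      simp only at e4
      linarith
    have hY := abs_lt.1 e3
    have hP := re_pos_of_mem_complexTube htube
    refine (tsum_of_norm_bounded ((summable_latticeNorm_natCast R').mul_left
      (C * q.2.1.re ^ (R' + 2))).hasSum fun p => h q htube hA (by linarith) hs' p).trans ?_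
    rw [tsum_mul_left]
    have hS : 0 ≤ ∑' p : {p : ℤ × ℤ // p ≠ 0}, ‖![p.1.1, p.1.2]‖ ^ (-((2 * (R' + 2) : ℕ) : ℝ)) :=
      tsum_nonneg fun p => by positivity
    calc C * q.2.1.re ^ (R' + 2) * ∑' p : {p : ℤ × ℤ // p ≠ 0},
          ‖![p.1.1, p.1.2]‖ ^ (-((2 * (R' + 2) : ℕ) : ℝ))
        ≤ C * (2 * y) ^ (R' + 2) * ∑' p : {p : ℤ × ℤ // p ≠ 0},
          ‖![p.1.1, p.1.2]‖ ^ (-((2 * (R' + 2) : ℕ) : ℝ)) := by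
          gcongr
          linarith
      _ = _ := by
        rw [mul_pow]
        ring

theorem isTame_weightZeroContinuation : IsTame weightZeroContinuation :=
  (IsTame.const _).add ((IsTame.const _).mul
    ((IsTame.snd_snd.mul (IsTame.snd_snd.add (IsTame.const _))).mul isTame_tsum_incompleteMellin))

theorem weightZeroContinuation_eq (z : UpperHalfPlane) {s : ℂ} (hs : 1 < s.re) :
    weightZeroContinuation ((z.re : ℂ), (z.im : ℂ), s) = doublyCompletedSeries 0 z s := by
  rw [doublyCompletedSeries_zero z hs, weightZeroContinuation]
  simp only [complexForm_ofReal, sub_eq_add_neg]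

end

/-! ### From weight zero to all even weights. -/

section

open Filter Topology

/-- The derivative in the complexified coordinate `x`. -/
def derivX (Φ : ℂ × ℂ × ℂ → ℂ) (p : ℂ × ℂ × ℂ) : ℂ := fderiv ℂ Φ p (1, 0, 0)

/-- The derivative in the complexified coordinate `y`. -/
def derivY (Φ : ℂ × ℂ × ℂ → ℂ) (p : ℂ × ℂ × ℂ) : ℂ := fderiv ℂ Φ p (0, 1, 0)

/-- The derivative in the variable `s`. -/
def derivS (Φ : ℂ × ℂ × ℂ → ℂ) (p : ℂ × ℂ × ℂ) : ℂ := fderiv ℂ Φ p (0, 0, 1)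

theorem IsTame.derivX {Φ : ℂ × ℂ × ℂ → ℂ} (h : IsTame Φ) : IsTame (derivX Φ) := h.fderiv_apply _

theorem IsTame.derivY {Φ : ℂ × ℂ × ℂ → ℂ} (h : IsTame Φ) : IsTame (derivY Φ) := h.fderiv_apply _

theorem IsTame.derivS {Φ : ℂ × ℂ × ℂ → ℂ} (h : IsTame Φ) : IsTame (derivS Φ) := h.fderiv_apply _

theorem IsTame.hasFDerivAt {Φ : ℂ × ℂ × ℂ → ℂ} (h : IsTame Φ) {p : ℂ × ℂ × ℂ}
    (hp : p ∈ complexTube) : HasFDerivAt Φ (fderiv ℂ Φ p) p :=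
  (h.differentiableOn.differentiableAt (isOpen_complexTube.mem_nhds hp)).hasFDerivAt

/-- The restriction of a function of the complexified coordinates to the real ones. -/
def toPlane (Φ : ℂ × ℂ × ℂ → ℂ) (s w : ℂ) : ℂ := Φ ((w.re : ℂ), (w.im : ℂ), s)

theorem coe_mem_complexTube (z : UpperHalfPlane) (s : ℂ) :
    (((z : ℂ).re : ℂ), ((z : ℂ).im : ℂ), s) ∈ complexTube :=
  ofReal_mem_complexTube _ z.im_pos s

theorem IsTame.hasDerivAt_toPlane {Φ : ℂ × ℂ × ℂ → ℂ} (h : IsTame Φ) (z : UpperHalfPlane)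
    (s v : ℂ) :
    HasDerivAt (fun t : ℝ => toPlane Φ s (z + t * v))
      (v.re * toPlane (PolyharmonicMaass.derivX Φ) s z
        + v.im * toPlane (PolyharmonicMaass.derivY Φ) s z) 0 := by
  have hlin : HasDerivAt (fun t : ℝ => (z : ℂ) + t * v) v 0 := by
    simpa using ((hasDerivAt_id (0 : ℝ)).ofReal_comp.mul_const v).const_add (z : ℂ)
  have hre : HasDerivAt (fun t : ℝ => ((((z : ℂ) + t * v).re : ℝ) : ℂ)) (v.re : ℂ) 0 :=
    (Complex.reCLM.hasFDerivAt.comp_hasDerivAt (0 : ℝ) hlin).ofReal_comp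
  have hpt := hre.prodMk ((hasDerivAt_im_line z v).prodMk (hasDerivAt_const (0 : ℝ) s))
  have hp := coe_mem_complexTube z s
  have hf : HasFDerivAt Φ (fderiv ℂ Φ (((z : ℂ).re : ℂ), ((z : ℂ).im : ℂ), s))
      ((((((z : ℂ) + (0 : ℝ) * v).re : ℝ) : ℂ)), ((((z : ℂ) + (0 : ℝ) * v).im : ℝ) : ℂ), s) := by
    simpa using h.hasFDerivAt hp
  refine ((hf.restrictScalars ℝ).comp_hasDerivAt (0 : ℝ) hpt).congr_deriv ?_
  rw [ContinuousLinearMap.coe_restrictScalars',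
    show ((v.re : ℂ), (v.im : ℂ), (0 : ℂ)) = (v.re : ℂ) • ((1 : ℂ), (0 : ℂ), (0 : ℂ)) +
      (v.im : ℂ) • ((0 : ℂ), (1 : ℂ), (0 : ℂ)) by simp, map_add, map_smul, map_smul]
  rfl

theorem IsTame.partialX_eq {Φ : ℂ × ℂ × ℂ → ℂ} (h : IsTame Φ) {f : UpperHalfPlane → ℂ} {s : ℂ}
    (hf : ∀ z : UpperHalfPlane, f z = toPlane Φ s z) (z : UpperHalfPlane) :
    partialX f z = toPlane (PolyharmonicMaass.derivX Φ) s z :=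
  PolyharmonicMaass.partialX_eq (g := toPlane Φ s) hf
    ((h.hasDerivAt_toPlane z s 1).congr_deriv (by simp))

theorem IsTame.partialY_eq {Φ : ℂ × ℂ × ℂ → ℂ} (h : IsTame Φ) {f : UpperHalfPlane → ℂ} {s : ℂ}
    (hf : ∀ z : UpperHalfPlane, f z = toPlane Φ s z) (z : UpperHalfPlane) :
    partialY f z = toPlane (PolyharmonicMaass.derivY Φ) s z :=
  PolyharmonicMaass.partialY_eq (g := toPlane Φ s) hf
    ((h.hasDerivAt_toPlane z s Complex.I).congr_deriv (by simp))

/-- `Φ` is a tame function of the complexified coordinates which continues the doubly-completed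
Eisenstein series of weight `k`. -/
structure IsTameContinuation (k : ℤ) (Φ : ℂ × ℂ × ℂ → ℂ) : Prop where
  tame : IsTame Φ
  eq_series : ∀ (z : UpperHalfPlane) (s : ℂ), 1 - (k : ℝ) / 2 < s.re →
    toPlane Φ s z = doublyCompletedSeries k z s

/-- The completing factor of the Eisenstein series. -/
def completingFactor (k : ℤ) (s : ℂ) : ℂ :=
  (s + (k : ℂ) / 2) * (s + (k : ℂ) / 2 - 1) * (Real.pi : ℂ) ^ (-s - (k : ℂ) / 2)
    * Complex.Gamma (s + (k : ℂ) / 2 + ((|k| : ℤ) : ℂ) / 2)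

theorem doublyCompletedSeries_eq (k : ℤ) (z : UpperHalfPlane) (s : ℂ) :
    doublyCompletedSeries k z s = completingFactor k s * planeSeries k z s := rfl

/-- For `k ≥ 0` the Gamma argument is `s + k`. The shift `(k, s + 1) → (k + 2, s)` fixes `s + k/2`
up to renaming and raises that argument by one, which yields exactly the factor `s + 1 + k`. -/
theorem completingFactor_raise {k : ℤ} (hk : 0 ≤ k) {s : ℂ} (hs : s + 1 + k ≠ 0) :
    completingFactor (k + 2) s = (s + 1 + k) * completingFactor k (s + 1) := by
  rw [completingFactor, completingFactor, abs_of_nonneg hk, abs_of_nonneg (by lia : 0 ≤ k + 2)]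
  push_cast
  rw [show s + ((k : ℂ) + 2) / 2 + ((k : ℂ) + 2) / 2 = (s + 1 + k) + 1 by ring,
    Complex.Gamma_add_one _ hs, show s + 1 + (k : ℂ) / 2 + (k : ℂ) / 2 = s + 1 + k by ring,
    show -s - ((k : ℂ) + 2) / 2 = -(s + 1) - (k : ℂ) / 2 by ring]
  ring

/-- The operator `i ∂x + ∂y + k/y = 2i ∂_z + k/y` kills the `∂_z̄` part and the weight `k` term. -/
theorem raise_planeSeries (k : ℤ) {w : ℂ} (s : ℂ) :
    Complex.I * planeSeriesDeriv k 1 w s + planeSeriesDeriv k Complex.I w s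
      + k / w.im * planeSeries k w s = (s + k) * planeSeries (k + 2) w (s - 1) := by
  simp only [planeSeriesDeriv, map_one, Complex.conj_I]
  have hI := Complex.I_ne_zero
  field_simp
  ring

/-- The raising operator preserves tameness. Its scalar `s + 1 + k` is the one in
`completingFactor_raise`, so no division occurs and no pole can appear. -/
theorem IsTameContinuation.raise {k : ℤ} (hk : 0 ≤ k) {Φ : ℂ × ℂ × ℂ → ℂ}
    (h : IsTameContinuation k Φ) : ∃ Ψ, IsTameContinuation (k + 2) Ψ := by
  have ht := ((IsTame.const Complex.I).mul h.tame.derivX).add (h.tame.derivY.add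
    ((IsTame.const (k : ℂ)).mul (IsTame.snd_fst_inv.mul h.tame)))
  refine ⟨_, ht.shift 1, fun z s hs => ?_⟩
  push_cast at hs
  have hs1 : 1 - (k : ℝ) / 2 < (s + 1).re := by
    rw [Complex.add_re, Complex.one_re]; linarith
  have hs2 : 2 < 2 * (s + 1).re + (k : ℝ) := by linarith
  have hk' : (0 : ℝ) ≤ k := by exact_mod_cast hk
  have hne : s + 1 + k ≠ 0 := fun h0 => by
    have := congrArg Complex.re h0
    simp only [Complex.add_re, Complex.one_re, Complex.intCast_re, Complex.zero_re] at this
    rw [Complex.add_re, Complex.one_re] at hs1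
    linarith
  have hser : ∀ z : UpperHalfPlane, doublyCompletedSeries k z (s + 1) = toPlane Φ (s + 1) z :=
    fun z => (h.eq_series z (s + 1) hs1).symm
  have hX := PolyharmonicMaass.partialX_eq
    (g := fun w => completingFactor k (s + 1) * planeSeries k w (s + 1))
    (fun z => doublyCompletedSeries_eq k z (s + 1))
    ((hasDerivAt_planeSeries k (w := z) z.im_pos hs2 1).const_mul _)
  have hY := PolyharmonicMaass.partialY_eq
    (g := fun w => completingFactor k (s + 1) * planeSeries k w (s + 1))
    (fun z => doublyCompletedSeries_eq k z (s + 1))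
    ((hasDerivAt_planeSeries k (w := z) z.im_pos hs2 Complex.I).const_mul _)
  rw [h.tame.partialX_eq hser] at hX
  rw [h.tame.partialY_eq hser] at hY
  have h0 := h.eq_series z (s + 1) hs1
  rw [doublyCompletedSeries_eq] at h0 ⊢
  have hr := raise_planeSeries k (w := z) (s + 1)
  simp only [planeSeriesDeriv, add_sub_cancel_right] at hr hX hY
  change Complex.I * toPlane (derivX Φ) (s + 1) z + (toPlane (derivY Φ) (s + 1) z +
    k * (((z : ℂ).im : ℂ)⁻¹ * toPlane Φ (s + 1) z)) = _
  rw [hX, hY, h0, completingFactor_raise hk hne]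
  linear_combination completingFactor k (s + 1) * hr

/-- Since `a⁻ⁿ = conj a ^ n / |a| ^ (2n)`, a sign change of the weight is a conjugation of `a`
together with a shift of `s` by `n`, up to `y ^ n`. -/
theorem planeTerm_reflect (n : ℕ) (z z' : UpperHalfPlane) (hz : (z' : ℂ) = -(starRingEnd ℂ) z)
    (s : ℂ) {p : ℤ × ℤ} (hp : p ≠ 0) :
    planeTerm (-n) z s p = (z.im : ℂ) ^ n * planeTerm n z' (s - n) (-p.1, p.2) := by
  have hp' : ((-p.1, p.2) : ℤ × ℤ) ≠ 0 := fun h => hp (Prod.ext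
    (by simpa using congrArg Prod.fst h) (by simpa using congrArg Prod.snd h))
  have ha := linear_ne_zero z.im_pos hp
  have hconj : (((-p.1 : ℤ) : ℂ) * (z' : ℂ) + (p.2 : ℂ)) =
      (starRingEnd ℂ) ((p.1 : ℂ) * z + (p.2 : ℂ)) := by
    rw [hz]
    simp
  have him : (z' : ℂ).im = (z : ℂ).im := by rw [hz]; simp
  rw [planeTerm_eq_exp _ z.im_pos _ hp, planeTerm_eq_exp _ z'.im_pos _ hp', hconj, him,
    Complex.normSq_conj]
  have hy : 0 < (z : ℂ).im := z.im_pos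
  set a := (p.1 : ℂ) * (z : ℂ) + (p.2 : ℂ) with hadef
  have hb : (starRingEnd ℂ) a ≠ 0 := (map_ne_zero (starRingEnd ℂ)).2 ha
  have hN : 0 < Complex.normSq a := Complex.normSq_pos.2 ha
  have hyc : ((z : ℂ).im : ℂ) ≠ 0 := by exact_mod_cast hy.ne'
  rw [sub_mul, Complex.exp_sub, Complex.exp_nat_mul, ← Complex.ofReal_exp,
    Real.exp_log (div_pos hy hN), neg_neg, zpow_natCast, zpow_neg, zpow_natCast,
    Complex.ofReal_div, Complex.normSq_eq_conj_mul_self, ← UpperHalfPlane.coe_im, div_pow, mul_pow]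
  field_simp

theorem completingFactor_neg (k : ℤ) (s : ℂ) :
    completingFactor (-k) s = completingFactor k (s - k) := by
  rw [completingFactor, completingFactor, abs_neg]
  push_cast
  rw [show s - (k : ℂ) + k / 2 = s + -(k : ℂ) / 2 by ring,
    show -(s - (k : ℂ)) - k / 2 = -s - -(k : ℂ) / 2 by ring]

theorem IsTameContinuation.reflect {n : ℕ} {Φ : ℂ × ℂ × ℂ → ℂ}
    (h : IsTameContinuation n Φ) : ∃ Ψ, IsTameContinuation (-n) Ψ := by
  refine ⟨_, (IsTame.snd_fst.pow n).mul (h.tame.shift (-n)).reflect, fun z s hs => ?_⟩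
  push_cast at hs
  let z' : UpperHalfPlane := ⟨⟨-z.re, z.im⟩, z.im_pos⟩
  have hz' : (z' : ℂ) = -(starRingEnd ℂ) z := by
    apply Complex.ext <;> simp [z']
  have h0 := h.eq_series z' (s + -n) (by simp; linarith)
  let e : {p : ℤ × ℤ // p ≠ 0} ≃ {p : ℤ × ℤ // p ≠ 0} :=
    ((Equiv.neg ℤ).prodCongr (Equiv.refl ℤ)).subtypeEquiv fun p => by
      simp [Prod.ext_iff]
  have hsum : planeSeries (-n) z s = (z.im : ℂ) ^ n * planeSeries n z' (s - n) := by
    have h1 : ∑' p : {p : ℤ × ℤ // p ≠ 0}, planeTerm (-n) z s p.1 =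
        (z.im : ℂ) ^ n * ∑' p : {p : ℤ × ℤ // p ≠ 0}, planeTerm n z' (s - n) (e p).1 := by
      rw [← tsum_mul_left]
      exact tsum_congr fun p => planeTerm_reflect n z z' hz' s p.2
    rw [planeSeries, planeSeries, h1, e.tsum_eq (fun p => planeTerm n z' (s - n) p.1)]
    ring
  have hpt : toPlane Φ (s + -n) z' = Φ (-((z : ℂ).re : ℂ), ((z : ℂ).im : ℂ), s + -n) := by
    rw [toPlane, hz']
    simp
  change ((z : ℂ).im : ℂ) ^ n * Φ (-((z : ℂ).re : ℂ), ((z : ℂ).im : ℂ), s + -n) = _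
  rw [← hpt, h0, doublyCompletedSeries_eq, doublyCompletedSeries_eq, completingFactor_neg, hsum,
    ← sub_eq_add_neg, UpperHalfPlane.coe_im]
  push_cast
  ring

theorem isTameContinuation_weightZero : IsTameContinuation 0 weightZeroContinuation :=
  ⟨isTame_weightZeroContinuation, fun z s hs => weightZeroContinuation_eq z (by simpa using hs)⟩

/-- Raising moves the weight by `2` from weight `0`, which is where evenness enters; negative
weights are reflections of positive ones. -/
theorem exists_isTameContinuation {k : ℤ} (hk : Even k) : ∃ Φ, IsTameContinuation k Φ := by
  have hnat : ∀ n : ℕ, ∃ Φ, IsTameContinuation ((2 * n : ℕ) : ℤ) Φ := by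
    intro n
    induction n with
    | zero => exact ⟨_, isTameContinuation_weightZero⟩
    | succ n ih =>
      obtain ⟨Φ, hΦ⟩ := ih
      obtain ⟨Ψ, hΨ⟩ := hΦ.raise (by positivity)
      refine ⟨Ψ, ?_⟩
      convert! hΨ using 1
  obtain ⟨r, rfl⟩ := hk
  obtain ⟨Φ, hΦ⟩ := hnat r.natAbs
  rcases le_total 0 r with hr | hr
  · refine ⟨Φ, ?_⟩
    convert! hΦ using 1
    lia
  · obtain ⟨Ψ, hΨ⟩ := hΦ.reflect
    refine ⟨Ψ, ?_⟩
    convert! hΨ using 1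
    lia

end

/-! ### The Taylor recursion and membership in the space of polyharmonic forms. -/

section

open Filter Topology

/-- The weight `k` Laplacian in the complexified coordinates. -/
def complexLaplacian (k : ℤ) (Φ : ℂ × ℂ × ℂ → ℂ) (p : ℂ × ℂ × ℂ) : ℂ :=
  p.2.1 ^ 2 * (derivX (derivX Φ) p + derivY (derivY Φ) p)
    - Complex.I * k * p.2.1 * (derivX Φ p + Complex.I * derivY Φ p)

theorem IsTame.laplacian_eq {Φ : ℂ × ℂ × ℂ → ℂ} (h : IsTame Φ) (k : ℤ) {f : UpperHalfPlane → ℂ}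
    {s : ℂ} (hf : ∀ z : UpperHalfPlane, f z = toPlane Φ s z) (z : UpperHalfPlane) :
    laplacian k f z = toPlane (complexLaplacian k Φ) s z := by
  rw [laplacian, h.partialX_eq hf, h.partialY_eq hf, h.derivX.partialX_eq (h.partialX_eq hf),
    h.derivY.partialY_eq (h.partialY_eq hf)]
  rfl

/-- The function of `s` obtained by fixing `z`. -/
theorem IsTame.hasDerivAt_snd {Φ : ℂ × ℂ × ℂ → ℂ} (h : IsTame Φ) (z : UpperHalfPlane) (s : ℂ) :
    HasDerivAt (fun s => toPlane Φ s z) (toPlane (PolyharmonicMaass.derivS Φ) s z) s := by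
  have hpt : HasDerivAt (fun s : ℂ => (((z : ℂ).re : ℂ), ((z : ℂ).im : ℂ), s))
      ((0 : ℂ), (0 : ℂ), (1 : ℂ)) s :=
    (hasDerivAt_const s _).prodMk ((hasDerivAt_const s _).prodMk (hasDerivAt_id s))
  exact (h.hasFDerivAt (coe_mem_complexTube z s)).comp_hasDerivAt s hpt

theorem IsTame.differentiable_snd {Φ : ℂ × ℂ × ℂ → ℂ} (h : IsTame Φ) (z : UpperHalfPlane) :
    Differentiable ℂ fun s => toPlane Φ s z := fun s => (h.hasDerivAt_snd z s).differentiableAt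

theorem fderiv_congr_on_complexTube {Φ Ψ : ℂ × ℂ × ℂ → ℂ} (h : ∀ p ∈ complexTube, Φ p = Ψ p)
    {p : ℂ × ℂ × ℂ} (hp : p ∈ complexTube) : fderiv ℂ Φ p = fderiv ℂ Ψ p :=
  Filter.EventuallyEq.fderiv_eq (mem_of_superset (isOpen_complexTube.mem_nhds hp) h)

theorem IsTame.derivS_derivX {Φ : ℂ × ℂ × ℂ → ℂ} (h : IsTame Φ) {p : ℂ × ℂ × ℂ}
    (hp : p ∈ complexTube) : PolyharmonicMaass.derivS (PolyharmonicMaass.derivX Φ) p =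
      PolyharmonicMaass.derivX (PolyharmonicMaass.derivS Φ) p :=
  fderiv_fderiv_apply_comm isOpen_complexTube h.differentiableOn hp _ _

theorem IsTame.derivS_derivY {Φ : ℂ × ℂ × ℂ → ℂ} (h : IsTame Φ) {p : ℂ × ℂ × ℂ}
    (hp : p ∈ complexTube) : PolyharmonicMaass.derivS (PolyharmonicMaass.derivY Φ) p =
      PolyharmonicMaass.derivY (PolyharmonicMaass.derivS Φ) p :=
  fderiv_fderiv_apply_comm isOpen_complexTube h.differentiableOn hp _ _

theorem IsTame.derivS_derivX_derivX {Φ : ℂ × ℂ × ℂ → ℂ} (h : IsTame Φ) {p : ℂ × ℂ × ℂ}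
    (hp : p ∈ complexTube) :
    PolyharmonicMaass.derivS (PolyharmonicMaass.derivX (PolyharmonicMaass.derivX Φ)) p =
      PolyharmonicMaass.derivX (PolyharmonicMaass.derivX (PolyharmonicMaass.derivS Φ)) p := by
  rw [h.derivX.derivS_derivX hp]
  exact congrArg (· (1, 0, 0)) (fderiv_congr_on_complexTube (fun q hq => h.derivS_derivX hq) hp)

theorem IsTame.derivS_derivY_derivY {Φ : ℂ × ℂ × ℂ → ℂ} (h : IsTame Φ) {p : ℂ × ℂ × ℂ}
    (hp : p ∈ complexTube) :
    PolyharmonicMaass.derivS (PolyharmonicMaass.derivY (PolyharmonicMaass.derivY Φ)) p =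
      PolyharmonicMaass.derivY (PolyharmonicMaass.derivY (PolyharmonicMaass.derivS Φ)) p := by
  rw [h.derivY.derivS_derivY hp]
  exact congrArg (· (0, 1, 0)) (fderiv_congr_on_complexTube (fun q hq => h.derivS_derivY hq) hp)

/-- Differentiation in `s` commutes with the Laplacian. -/
theorem IsTame.hasDerivAt_complexLaplacian {Φ : ℂ × ℂ × ℂ → ℂ} (h : IsTame Φ) (k : ℤ)
    (z : UpperHalfPlane) (s : ℂ) :
    HasDerivAt (fun s => toPlane (complexLaplacian k Φ) s z)
      (toPlane (complexLaplacian k (PolyharmonicMaass.derivS Φ)) s z) s := by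
  have hp := coe_mem_complexTube z s
  have hXX := h.derivX.derivX.hasDerivAt_snd z s
  have hYY := h.derivY.derivY.hasDerivAt_snd z s
  have hX := h.derivX.hasDerivAt_snd z s
  have hY := h.derivY.hasDerivAt_snd z s
  refine (((hXX.add hYY).const_mul (((z : ℂ).im : ℂ) ^ 2)).sub
    ((hX.add (hY.const_mul Complex.I)).const_mul
      (Complex.I * k * ((z : ℂ).im : ℂ)))).congr_deriv ?_
  simp only [toPlane, complexLaplacian]
  rw [h.derivS_derivX_derivX hp, h.derivS_derivY_derivY hp, h.derivS_derivX hp,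
    h.derivS_derivY hp]

/-- Two entire functions which agree on a right half-plane are equal. -/
theorem eq_of_eq_on_halfPlane {F G : ℂ → ℂ} (hF : Differentiable ℂ F) (hG : Differentiable ℂ G)
    {c : ℝ} (h : ∀ s : ℂ, c < s.re → F s = G s) : F = G := by
  refine AnalyticOnNhd.eq_of_eventuallyEq (z₀ := ((c + 1 : ℝ) : ℂ))
    (hF.differentiableOn.analyticOnNhd isOpen_univ)
    (hG.differentiableOn.analyticOnNhd isOpen_univ) ?_
  have hopen : IsOpen {s : ℂ | c < s.re} := isOpen_lt continuous_const Complex.continuous_re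
  refine mem_of_superset (hopen.mem_nhds ?_) h
  simp

/-- Iterated derivatives in `s`. -/
def iterDerivS (n : ℕ) (Φ : ℂ × ℂ × ℂ → ℂ) : ℂ × ℂ × ℂ → ℂ := derivS^[n] Φ

theorem iterDerivS_succ (n : ℕ) (Φ : ℂ × ℂ × ℂ → ℂ) :
    iterDerivS (n + 1) Φ = derivS (iterDerivS n Φ) := Function.iterate_succ_apply' _ _ _

theorem IsTame.iterDerivS {Φ : ℂ × ℂ × ℂ → ℂ} (h : IsTame Φ) (n : ℕ) :
    IsTame (iterDerivS n Φ) := by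
  induction n with
  | zero => exact h
  | succ n ih =>
    rw [iterDerivS_succ]
    exact ih.derivS

theorem IsTame.iteratedDeriv_eq {Φ : ℂ × ℂ × ℂ → ℂ} (h : IsTame Φ) (n : ℕ) (z : UpperHalfPlane) :
    iteratedDeriv n (fun s => toPlane Φ s z) =
      fun s => toPlane (PolyharmonicMaass.iterDerivS n Φ) s z := by
  induction n with
  | zero => rfl
  | succ n ih =>
    rw [iteratedDeriv_succ, ih, iterDerivS_succ]
    funext s
    exact ((h.iterDerivS n).hasDerivAt_snd z s).deriv

namespace IsTameContinuation

variable {k : ℤ} {Φ : ℂ × ℂ × ℂ → ℂ}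

theorem isEntireContinuation (h : IsTameContinuation k Φ) (z : UpperHalfPlane) :
    IsEntireContinuation k z fun s => toPlane Φ s z :=
  ⟨h.tame.differentiable_snd z, fun s hs => h.eq_series z s hs⟩

theorem doublyCompleted_isEntireContinuation (h : IsTameContinuation k Φ) (z : UpperHalfPlane) :
    IsEntireContinuation k z (doublyCompletedEisenstein k z) := by
  have hex : ∃ F, IsEntireContinuation k z F := ⟨_, h.isEntireContinuation z⟩
  rw [doublyCompletedEisenstein, dif_pos hex]
  exact hex.choose_spec

theorem doublyCompleted_eq (h : IsTameContinuation k Φ) (z : UpperHalfPlane) :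
    doublyCompletedEisenstein k z = fun s => toPlane Φ s z := by
  have h1 := h.doublyCompleted_isEntireContinuation z
  have h2 := h.isEntireContinuation z
  exact eq_of_eq_on_halfPlane h1.1 h2.1 fun s hs => (h1.2 s hs).trans (h2.2 s hs).symm

theorem taylorCoeff_eq (h : IsTameContinuation k Φ) (n : ℕ) (s₀ : ℂ) (z : UpperHalfPlane) :
    taylorCoeff k n s₀ z = toPlane (iterDerivS n Φ) s₀ z := by
  rw [taylorCoeff, h.doublyCompleted_eq, h.tame.iteratedDeriv_eq]

/-- Both sides are entire in `s`. In the half-plane of convergence the completing factor is a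
constant in `z` and the equation is that of the series. -/
theorem complexLaplacian_eq (h : IsTameContinuation k Φ) (z : UpperHalfPlane) (s : ℂ) :
    toPlane (complexLaplacian k Φ) s z = s * (s + k - 1) * toPlane Φ s z := by
  have key : (fun s => toPlane (complexLaplacian k Φ) s z) =
      fun s => s * (s + k - 1) * toPlane Φ s z := by
    refine eq_of_eq_on_halfPlane (c := 1 - (k : ℝ) / 2)
      (fun s => (h.tame.hasDerivAt_complexLaplacian k z s).differentiableAt)
      (fun s => DifferentiableAt.mul (by fun_prop) (h.tame.differentiable_snd z s)) fun s hs => ?_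
    have hser : ∀ z : UpperHalfPlane,
        completingFactor k s * eisensteinSeries k z s = toPlane Φ s z := fun z =>
      (h.eq_series z s hs).symm
    have hX : partialX (fun z => completingFactor k s * eisensteinSeries k z s) =
        fun z => completingFactor k s * partialX (fun z => eisensteinSeries k z s) z :=
      funext fun z => deriv_const_mul_field _
    have hY : partialY (fun z => completingFactor k s * eisensteinSeries k z s) =
        fun z => completingFactor k s * partialY (fun z => eisensteinSeries k z s) z :=
      funext fun z => deriv_const_mul_field _
    have hXX : partialX (fun z => completingFactor k s *
        partialX (fun z => eisensteinSeries k z s) z) z =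
        completingFactor k s * partialX (partialX fun z => eisensteinSeries k z s) z :=
      deriv_const_mul_field _
    have hYY : partialY (fun z => completingFactor k s *
        partialY (fun z => eisensteinSeries k z s) z) z =
        completingFactor k s * partialY (partialY fun z => eisensteinSeries k z s) z :=
      deriv_const_mul_field _
    have hE := laplacian_eisensteinSeries k (s := s) (by linarith) z
    rw [laplacian] at hE
    rw [← h.tame.laplacian_eq k hser z, ← hser z, laplacian, hX, hY, hXX, hYY]
    linear_combination completingFactor k s * hE
  exact congrFun key s

/-- The Taylor recursion for the Laplacian. -/
theorem complexLaplacian_iterDerivS (h : IsTameContinuation k Φ) (n : ℕ) (z : UpperHalfPlane)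
    (s : ℂ) :
    toPlane (complexLaplacian k (iterDerivS n Φ)) s z =
      s * (s + k - 1) * toPlane (iterDerivS n Φ) s z
      + n * (2 * s + k - 1) * toPlane (iterDerivS (n - 1) Φ) s z
      + n * (n - 1) * toPlane (iterDerivS (n - 2) Φ) s z := by
  induction n generalizing s with
  | zero => simpa using! h.complexLaplacian_eq z s
  | succ n ih =>
    have hL := (h.tame.iterDerivS n).hasDerivAt_complexLaplacian k z s
    have hd : ∀ m, HasDerivAt (fun s => toPlane (iterDerivS m Φ) s z)
        (toPlane (iterDerivS (m + 1) Φ) s z) s := fun m => by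
      rw [iterDerivS_succ]
      exact (h.tame.iterDerivS m).hasDerivAt_snd z s
    have hq : HasDerivAt (fun s : ℂ => s * (s + k - 1)) (2 * s + k - 1) s := by
      refine ((hasDerivAt_id s).mul (((hasDerivAt_id s).add_const (k : ℂ)).sub_const 1)).congr_deriv
        ?_
      simp only [id]
      ring
    have hl : HasDerivAt (fun s : ℂ => (n : ℂ) * (2 * s + k - 1)) ((n : ℂ) * 2) s := by
      refine ((((hasDerivAt_id s).const_mul 2).add_const (k : ℂ)).sub_const 1).const_mul
        (n : ℂ) |>.congr_deriv ?_
      simp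
    have hR := ((hq.mul (hd n)).add (hl.mul (hd (n - 1)))).add
      ((hd (n - 2)).const_mul ((n : ℂ) * (n - 1)))
    have heq := hL.unique (hR.congr_of_eventuallyEq (Eventually.of_forall fun s => ih s))
    rw [iterDerivS_succ, heq, ← iterDerivS_succ]
    -- For `n = 0` and `n = 1` the truncated indices are wrong, but their coefficients `n` or `n (n
    -- - 1)` vanish; only from `2` on does the shift by one hold literally.
    rcases n with _ | _ | n
    · simp
      ring
    · simp
      ring
    · simp only [Nat.add_sub_cancel, show n + 1 + 1 - 2 = n by lia,
        show n + 1 + 1 + 1 - 2 = n + 1 by lia, show n + 1 + 1 - 1 = n + 1 by lia]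
      push_cast
      ring

theorem shiftedLaplacian_taylorCoeff (h : IsTameContinuation k Φ) (n : ℕ) (s₀ : ℂ)
    (z : UpperHalfPlane) :
    shiftedLaplacian k (s₀ * (s₀ + k - 1)) (taylorCoeff k n s₀) z =
      n * (2 * s₀ + k - 1) * taylorCoeff k (n - 1) s₀ z
      + n * (n - 1) * taylorCoeff k (n - 2) s₀ z := by
  rw [shiftedLaplacian, (h.tame.iterDerivS n).laplacian_eq k (h.taylorCoeff_eq n s₀),
    h.complexLaplacian_iterDerivS, h.taylorCoeff_eq, h.taylorCoeff_eq, h.taylorCoeff_eq]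
  ring

/-- The coefficient is a holomorphic function on the tube restricted along a real affine embedding
of the half-plane. -/
theorem isSmooth_taylorCoeff (h : IsTameContinuation k Φ) (n : ℕ) (s₀ : ℂ) :
    IsSmooth (taylorCoeff k n s₀) := by
  have hc := (contDiffOn_of_differentiableOn isOpen_complexTube
    (h.tame.iterDerivS n).differentiableOn).restrict_scalars ℝ
  have hg : ContDiff ℝ ∞ (fun w : ℂ => ((w.re : ℂ), (w.im : ℂ), s₀)) := by
    have hre : ContDiff ℝ ∞ (fun w : ℂ => (w.re : ℂ)) :=
      (Complex.ofRealCLM.comp Complex.reCLM).contDiff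
    have him : ContDiff ℝ ∞ (fun w : ℂ => (w.im : ℂ)) :=
      (Complex.ofRealCLM.comp Complex.imCLM).contDiff
    exact hre.prodMk (him.prodMk contDiff_const)
  refine (hc.comp hg.contDiffOn (fun w hw => ofReal_mem_complexTube _ hw s₀)).congr
    fun w hw => ?_
  rw [h.taylorCoeff_eq, UpperHalfPlane.ofComplex_apply_of_im_pos hw]
  rfl

theorem isModularOfWeight_taylorCoeff (h : IsTameContinuation k Φ) (n : ℕ) (s₀ : ℂ) :
    IsModularOfWeight k (taylorCoeff k n s₀) := by
  intro γ z
  have h1 := h.doublyCompleted_isEntireContinuation (γ • z)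
  have h2 := h.doublyCompleted_isEntireContinuation z
  have key : doublyCompletedEisenstein k (γ • z) = fun s =>
      (((γ 1 0 : ℤ) : ℂ) * (z : ℂ) + ((γ 1 1 : ℤ) : ℂ)) ^ k * doublyCompletedEisenstein k z s := by
    refine eq_of_eq_on_halfPlane (c := 1 - (k : ℝ) / 2) h1.1 (h2.1.const_mul _) fun s hs => ?_
    rw [h1.2 s hs, h2.2 s hs, doublyCompletedSeries, doublyCompletedSeries, eisensteinSeries_smul]
    ring
  rw [taylorCoeff, taylorCoeff, key, iteratedDeriv_const_mul_field]

theorem hasModerateGrowth_taylorCoeff (h : IsTameContinuation k Φ) (n : ℕ) (s₀ : ℂ) :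
    HasModerateGrowth (taylorCoeff k n s₀) := by
  obtain ⟨δ, hδ, -, C, K, hb⟩ := (h.tame.iterDerivS n).growth 1 ‖s₀‖
  refine ⟨K, Asymptotics.IsBigO.of_bound C ?_⟩
  refine UpperHalfPlane.atImInfty_mem _ |>.2 ⟨1, fun z hz => ?_⟩
  -- Tameness is uniform only for bounded `x`; invariance under `z ↦ z + 1` brings every point to `0
  -- ≤ x < 1`.
  set m : ℤ := -⌊z.re⌋ with hm
  have hT : taylorCoeff k n s₀ (ModularGroup.T ^ m • z) = taylorCoeff k n s₀ z := by
    rw [h.isModularOfWeight_taylorCoeff n s₀ (ModularGroup.T ^ m) z, ModularGroup.coe_T_zpow]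
    simp
  have hcoe := ModularGroup.coe_T_zpow_smul_eq (z := z) (n := m)
  set z' : UpperHalfPlane := ModularGroup.T ^ m • z with hz'
  have hre : (z' : ℂ).re = z.re - ⌊z.re⌋ := by
    rw [hcoe]
    simp [hm, sub_eq_add_neg]
  have him : (z' : ℂ).im = z.im := by
    rw [hcoe]
    simp
  have hx : |(z' : ℂ).re| ≤ 1 := by
    rw [hre, abs_of_nonneg (sub_nonneg.2 (Int.floor_le _))]
    linarith [Int.lt_floor_add_one z.re]
  have hz0 : 0 ≤ z.im := z.im_pos.le
  simp only [Set.mem_ofPred_eq]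
  rw [← hT, h.taylorCoeff_eq, Real.norm_of_nonneg (by positivity), ← him]
  exact hb _ _ s₀ hx (by rw [him]; exact hz) le_rfl _ (Metric.mem_ball_self hδ)

end IsTameContinuation

/-- Functions on `ℍ` which are slices of tame functions. -/
def IsTameSlice (f : UpperHalfPlane → ℂ) : Prop :=
  ∃ (Φ : ℂ × ℂ × ℂ → ℂ) (s : ℂ), IsTame Φ ∧ ∀ z : UpperHalfPlane, f z = toPlane Φ s z

namespace IsTameSlice

variable {f g : UpperHalfPlane → ℂ}

theorem partialX (hf : IsTameSlice f) : IsTameSlice (partialX f) := by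
  obtain ⟨Φ, s, h, hs⟩ := hf
  exact ⟨_, s, h.derivX, h.partialX_eq hs⟩

theorem partialY (hf : IsTameSlice f) : IsTameSlice (partialY f) := by
  obtain ⟨Φ, s, h, hs⟩ := hf
  exact ⟨_, s, h.derivY, h.partialY_eq hs⟩

theorem differentiableAt_line (hf : IsTameSlice f) (z : UpperHalfPlane) (v : ℂ) :
    DifferentiableAt ℝ (fun t : ℝ => f (UpperHalfPlane.ofComplex (z + t * v))) 0 := by
  obtain ⟨Φ, s, h, hs⟩ := hf
  exact (hasDerivAt_line hs (h.hasDerivAt_toPlane z s v)).differentiableAt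

theorem partialX_add (hf : IsTameSlice f) (hg : IsTameSlice g) (c d : ℂ) :
    PolyharmonicMaass.partialX (fun z => c * f z + d * g z) =
      fun z => c * PolyharmonicMaass.partialX f z + d * PolyharmonicMaass.partialX g z := by
  funext z
  have h1 := hf.differentiableAt_line z 1
  have h2 := hg.differentiableAt_line z 1
  simp only [mul_one] at h1 h2
  exact ((h1.hasDerivAt.const_mul c).add (h2.hasDerivAt.const_mul d)).deriv

theorem partialY_add (hf : IsTameSlice f) (hg : IsTameSlice g) (c d : ℂ) :
    PolyharmonicMaass.partialY (fun z => c * f z + d * g z) =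
      fun z => c * PolyharmonicMaass.partialY f z + d * PolyharmonicMaass.partialY g z := by
  funext z
  have h1 := hf.differentiableAt_line z Complex.I
  have h2 := hg.differentiableAt_line z Complex.I
  exact ((h1.hasDerivAt.const_mul c).add (h2.hasDerivAt.const_mul d)).deriv

theorem shiftedLaplacian_add (hf : IsTameSlice f) (hg : IsTameSlice g) (k : ℤ) (lam c d : ℂ) :
    shiftedLaplacian k lam (fun z => c * f z + d * g z) =
      fun z => c * shiftedLaplacian k lam f z + d * shiftedLaplacian k lam g z := by
  funext z
  simp only [shiftedLaplacian, laplacian]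
  rw [hf.partialX_add hg, hf.partialY_add hg, hf.partialX.partialX_add hg.partialX,
    hf.partialY.partialY_add hg.partialY]
  ring

/-- `partialX` and `partialY` are additive only on differentiable functions. Stability of the class
under the operator lets linearity be used at every iterate. -/
theorem shiftedLaplacian (hf : IsTameSlice f) (k : ℤ) (lam : ℂ) :
    IsTameSlice (shiftedLaplacian k lam f) := by
  obtain ⟨Φ, s, h, hs⟩ := hf
  refine ⟨_, s, (((IsTame.snd_fst.pow 2).mul (h.derivX.derivX.add h.derivY.derivY)).add
    (((IsTame.const (-(Complex.I * k))).mul IsTame.snd_fst).mul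
      (h.derivX.add ((IsTame.const Complex.I).mul h.derivY)))).add ((IsTame.const (-lam)).mul h),
    fun z => ?_⟩
  rw [PolyharmonicMaass.shiftedLaplacian, h.laplacian_eq k hs, hs]
  simp only [toPlane, complexLaplacian]
  ring

theorem iterate_shiftedLaplacian_add (k : ℤ) (lam c d : ℂ) (m : ℕ) (hf : IsTameSlice f)
    (hg : IsTameSlice g) :
    (PolyharmonicMaass.shiftedLaplacian k lam)^[m] (fun z => c * f z + d * g z) =
      fun z => c * (PolyharmonicMaass.shiftedLaplacian k lam)^[m] f z
        + d * (PolyharmonicMaass.shiftedLaplacian k lam)^[m] g z := by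
  induction m generalizing f g with
  | zero => rfl
  | succ m ih =>
    simp only [Function.iterate_succ_apply]
    rw [hf.shiftedLaplacian_add hg, ih (hf.shiftedLaplacian k lam) (hg.shiftedLaplacian k lam)]

end IsTameSlice

/-- One application lands in the span of the coefficients `n - 1` and `n - 2`. The induction needs
every `m > n`, because the second of them dies earlier. -/
theorem IsTameContinuation.iterate_shiftedLaplacian_taylorCoeff {k : ℤ} {Φ : ℂ × ℂ × ℂ → ℂ}
    (h : IsTameContinuation k Φ) (s₀ : ℂ) (n m : ℕ) (hnm : n < m) (z : UpperHalfPlane) :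
    (shiftedLaplacian k (s₀ * (s₀ + k - 1)))^[m] (taylorCoeff k n s₀) z = 0 := by
  have hslice : ∀ n, IsTameSlice (taylorCoeff k n s₀) := fun n =>
    ⟨_, s₀, h.tame.iterDerivS n, h.taylorCoeff_eq n s₀⟩
  induction n using Nat.strong_induction_on generalizing m with
  | _ n ih =>
    obtain ⟨m, rfl⟩ := Nat.exists_eq_succ_of_ne_zero (Nat.ne_zero_of_lt hnm)
    rw [Function.iterate_succ_apply, funext (h.shiftedLaplacian_taylorCoeff n s₀),
      IsTameSlice.iterate_shiftedLaplacian_add k _ _ _ m (hslice _) (hslice _)]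
    rcases n with _ | n
    · simp
    · beta_reduce
      -- At index `1` the truncated second index is `0`, still smaller, so the induction hypothesis
      -- covers it too.
      rw [ih (n + 1 - 1) (by lia) m (by lia), ih (n + 1 - 2) (by lia) m (by lia)]
      simp

end

end PolyharmonicMaass

end

/-- In the recursion the coefficients `n` and `n (n - 1)` vanish whenever the (truncated) index
`n - 1`, respectively `n - 2`, would be negative. -/
theorem mainTheorem5 (k : ℤ) (hk : Even k) :
    (∀ (z : UpperHalfPlane) (s : ℂ), 1 - (k : ℝ) / 2 < s.re →
      Summable fun p : {p : ℤ × ℤ // p ≠ 0} => PolyharmonicMaass.eisensteinTerm k z s p.1) ∧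
    (∀ z : UpperHalfPlane, PolyharmonicMaass.IsEntireContinuation k z
      (PolyharmonicMaass.doublyCompletedEisenstein k z)) ∧
    (∀ s₀ lam : ℂ, lam = s₀ * (s₀ + (k : ℂ) - 1) →
      (∀ (n : ℕ) (z : UpperHalfPlane),
        PolyharmonicMaass.shiftedLaplacian k lam (PolyharmonicMaass.taylorCoeff k n s₀) z =
          (n : ℂ) * (2 * s₀ + (k : ℂ) - 1) * PolyharmonicMaass.taylorCoeff k (n - 1) s₀ z
          + (n : ℂ) * ((n : ℂ) - 1) * PolyharmonicMaass.taylorCoeff k (n - 2) s₀ z) ∧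
      (∀ n : ℕ, PolyharmonicMaass.taylorCoeff k n s₀ ∈
        PolyharmonicMaass.shiftedPolyharmonicMaassForms k (n + 1) lam)) := by
  obtain ⟨Φ, h⟩ := PolyharmonicMaass.exists_isTameContinuation hk
  refine ⟨fun z s hs => PolyharmonicMaass.summable_planeTerm k z.im_pos (by linarith),
    h.doublyCompleted_isEntireContinuation, ?_⟩
  rintro s₀ lam rfl
  exact ⟨fun n z => h.shiftedLaplacian_taylorCoeff n s₀ z, fun n =>
    ⟨h.isSmooth_taylorCoeff n s₀, h.isModularOfWeight_taylorCoeff n s₀,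
      h.hasModerateGrowth_taylorCoeff n s₀,
      h.iterate_shiftedLaplacian_taylorCoeff s₀ n (n + 1) (Nat.lt_succ_self n)⟩⟩
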